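/- Let $L>0$, $a>0$, $b>0$ and $\alpha_1,\alpha_2\ge 0$ be real numbers. Let $X_0=L^2(0,L)\times L^2(0,L)$ be the real Hilbert space with its usual inner product, and let $A:D(A)\subset X_0\to X_0$ be the operator $$A(\eta,u)=\left(-u_x+a\,u_{xxx}-b\,u_{xxxxx},\; -\eta_x+a\,\eta_{xxx}-b\,\eta_{xxxxx}\right)$$ with domain $$D(A)=\left\{(\eta,u)\in [H^5(0,L)\cap H^2_0(0,L)]^2:\ u_{xx}(0)+\alpha_1\eta_{xx}(0)=0,\ u_{xx}(L)-\alpha_2\eta_{xx}(L)=0\right\}.$$ Then $A$ generates a $C_0$-semigroup of contractions $(S(t))_{t\ge 0}$ on $X_0$; that is, $A$ is exactly the infinitesimal generator of such a semigroup. Moreover, $D(A)$ is dense in $X_0$, and both $A$ and its adjoint $A^*$ are dissipative, i.e. $\langle AU,U\rangle_{X_0}\le 0$ for all $U\in D(A)$ and $\langle A^*V,V\rangle_{X_0}\le 0$ for all $V\in D(A^*)$. -/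

import Mathlib

namespace FifthOrderKdV

open MeasureTheory Set Filter Topology
open scoped ContDiff NNReal

/-- Lebesgue measure on the interval `(0, L)`. -/
noncomputable abbrev intervalMeasure (L : ℝ) : Measure ℝ := volume.restrict (Ioo 0 L)

/-- The real Hilbert space `L²(0, L)`. -/
noncomputable abbrev L2 (L : ℝ) := Lp ℝ 2 (intervalMeasure L)

/-- Test functions on `(0, L)`: the elements of `C_c^∞(0, L)`. -/
def IsTest (L : ℝ) (φ : ℝ → ℝ) : Prop :=
  ContDiff ℝ ∞ φ ∧ HasCompactSupport φ ∧ tsupport φ ⊆ Ioo 0 L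

/-- `g` is the `k`-th weak (distributional) derivative of `f` on `(0, L)`. -/
def IsWeakDeriv (L : ℝ) (k : ℕ) (f g : L2 L) : Prop :=
  ∀ φ : ℝ → ℝ, IsTest L φ →
    ∫ x in Ioo 0 L, f x * iteratedDeriv k φ x = (-1) ^ k * ∫ x in Ioo 0 L, g x * φ x

theorem IsTest.memLp_iteratedDeriv {L : ℝ} {φ : ℝ → ℝ} (hφ : IsTest L φ) (k : ℕ) :
    MemLp (iteratedDeriv k φ) 2 (intervalMeasure L) := by
  have hc : Continuous (iteratedDeriv k φ) :=
    hφ.1.continuous_iteratedDeriv k (by exact_mod_cast le_top)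
  have hs : HasCompactSupport (iteratedDeriv k φ) := by
    induction k with
    | zero => simpa using hφ.2.1
    | succ k ih =>
      rw [iteratedDeriv_succ]
      exact (ih (hφ.1.continuous_iteratedDeriv k (by exact_mod_cast le_top))).deriv
  exact hc.memLp_of_hasCompactSupport hs

theorem IsTest.memLp {L : ℝ} {φ : ℝ → ℝ} (hφ : IsTest L φ) :
    MemLp φ 2 (intervalMeasure L) := by
  simpa using hφ.memLp_iteratedDeriv 0

theorem integrable_mul {L : ℝ} (f : L2 L) {φ : ℝ → ℝ} (hφ : MemLp φ 2 (intervalMeasure L)) :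
    Integrable (fun x => f x * φ x) (intervalMeasure L) :=
  (Lp.memLp f).integrable_mul hφ

theorem integral_add_mul {L : ℝ} (f g : L2 L) {φ : ℝ → ℝ} (hφ : MemLp φ 2 (intervalMeasure L)) :
    ∫ x in Ioo 0 L, (f + g : L2 L) x * φ x
      = (∫ x in Ioo 0 L, f x * φ x) + ∫ x in Ioo 0 L, g x * φ x := by
  rw [← integral_add (integrable_mul f hφ) (integrable_mul g hφ)]
  refine integral_congr_ae ?_
  filter_upwards [Lp.coeFn_add f g] with x hx
  rw [hx, Pi.add_apply, add_mul]

theorem integral_smul_mul {L : ℝ} (c : ℝ) (f : L2 L) (φ : ℝ → ℝ) :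
    ∫ x in Ioo 0 L, (c • f : L2 L) x * φ x = c * ∫ x in Ioo 0 L, f x * φ x := by
  rw [← integral_const_mul]
  refine integral_congr_ae ?_
  filter_upwards [Lp.coeFn_smul c f] with x hx
  rw [hx, Pi.smul_apply, smul_eq_mul, mul_assoc]

theorem IsWeakDeriv.add {L : ℝ} {k : ℕ} {f g f' g' : L2 L} (h : IsWeakDeriv L k f g)
    (h' : IsWeakDeriv L k f' g') : IsWeakDeriv L k (f + f') (g + g') := by
  intro φ hφ
  rw [integral_add_mul _ _ (hφ.memLp_iteratedDeriv k), integral_add_mul _ _ hφ.memLp,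
    h φ hφ, h' φ hφ, mul_add]

theorem IsWeakDeriv.smul {L : ℝ} {k : ℕ} {f g : L2 L} (c : ℝ) (h : IsWeakDeriv L k f g) :
    IsWeakDeriv L k (c • f) (c • g) := by
  intro φ hφ
  rw [integral_smul_mul, integral_smul_mul, h φ hφ]
  ring

theorem isWeakDeriv_zero (L : ℝ) (k : ℕ) : IsWeakDeriv L k 0 0 := by
  have h : ∀ ψ : ℝ → ℝ, ∫ x in Ioo 0 L, (0 : L2 L) x * ψ x = 0 := fun ψ => by
    simpa using integral_smul_mul 0 (0 : L2 L) ψ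
  intro φ _
  rw [h, h, mul_zero]

/-- Weak derivatives are unique. -/
theorem IsWeakDeriv.unique {L : ℝ} {k : ℕ} {f g g' : L2 L} (h : IsWeakDeriv L k f g)
    (h' : IsWeakDeriv L k f g') : g = g' := by
  rw [← sub_eq_zero]
  have h0 : IsWeakDeriv L k 0 (g - g') := by
    have := h.add (h'.smul (-1))
    simpa [sub_eq_add_neg] using this
  have hl : LocallyIntegrable (fun x => (g - g' : L2 L) x) (intervalMeasure L) :=
    (Lp.memLp (g - g')).locallyIntegrable (by norm_num)
  have key := isOpen_Ioo.ae_eq_zero_of_integral_contDiff_smul_eq_zero (U := Ioo 0 L)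
    (μ := intervalMeasure L) (hl.locallyIntegrableOn _) (fun φ h1 h2 h3 => by
      have e := h0 φ ⟨h1, h2, h3⟩
      have z : ∫ x in Ioo 0 L, (0 : L2 L) x * iteratedDeriv k φ x = 0 := by
        simpa using integral_smul_mul 0 (0 : L2 L) (iteratedDeriv k φ)
      rw [z] at e
      have e' := (mul_eq_zero.1 e.symm).resolve_left (by simp)
      simpa [mul_comm] using e')
  rw [Lp.eq_zero_iff_ae_eq_zero]
  filter_upwards [key, ae_restrict_mem measurableSet_Ioo] with x hx hm
  exact hx hm

open Classical in
/-- The `k`-th weak derivative of `f` if it exists in `L²(0, L)` (and `0` otherwise). -/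
noncomputable def weakDeriv (L : ℝ) (k : ℕ) (f : L2 L) : L2 L :=
  if h : ∃ g, IsWeakDeriv L k f g then h.choose else 0

theorem IsWeakDeriv.weakDeriv_eq {L : ℝ} {k : ℕ} {f g : L2 L} (h : IsWeakDeriv L k f g) :
    weakDeriv L k f = g := by
  have hex : ∃ g, IsWeakDeriv L k f g := ⟨g, h⟩
  rw [weakDeriv, dif_pos hex]
  exact hex.choose_spec.unique h

/-- The Sobolev space `H^m(0, L)`: all weak derivatives up to order `m` exist in `L²(0, L)`. -/
def H (L : ℝ) (m : ℕ) : Submodule ℝ (L2 L) where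
  carrier := {f | ∀ k ≤ m, ∃ g, IsWeakDeriv L k f g}
  add_mem' hf hf' k hk := by
    obtain ⟨g, hg⟩ := hf k hk
    obtain ⟨g', hg'⟩ := hf' k hk
    exact ⟨g + g', hg.add hg'⟩
  zero_mem' k _ := ⟨0, isWeakDeriv_zero L k⟩
  smul_mem' c f hf k hk := by
    obtain ⟨g, hg⟩ := hf k hk
    exact ⟨c • g, hg.smul c⟩

theorem weakDeriv_add {L : ℝ} {m k : ℕ} (hk : k ≤ m) {f f' : L2 L} (hf : f ∈ H L m)
    (hf' : f' ∈ H L m) : weakDeriv L k (f + f') = weakDeriv L k f + weakDeriv L k f' := by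
  obtain ⟨g, hg⟩ := hf k hk
  obtain ⟨g', hg'⟩ := hf' k hk
  rw [(hg.add hg').weakDeriv_eq, hg.weakDeriv_eq, hg'.weakDeriv_eq]

theorem weakDeriv_smul {L : ℝ} {m k : ℕ} (hk : k ≤ m) (c : ℝ) {f : L2 L} (hf : f ∈ H L m) :
    weakDeriv L k (c • f) = c • weakDeriv L k f := by
  obtain ⟨g, hg⟩ := hf k hk
  rw [(hg.smul c).weakDeriv_eq, hg.weakDeriv_eq]

/-- `f ↦ (f, f', …, f^(m))`, the embedding of `H^m(0, L)` into `L²(0, L)^(m+1)` that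
induces the topology of `H^m(0, L)`. -/
noncomputable def jet (L : ℝ) (m : ℕ) : H L m →ₗ[ℝ] (Fin (m + 1) → L2 L) where
  toFun f k := weakDeriv L k f
  map_add' f f' := by
    ext1 k
    exact weakDeriv_add (Nat.lt_succ_iff.1 k.2) f.2 f'.2
  map_smul' c f := by
    ext1 k
    exact weakDeriv_smul (Nat.lt_succ_iff.1 k.2) c f.2

theorem IsTest.add {L : ℝ} {φ ψ : ℝ → ℝ} (hφ : IsTest L φ) (hψ : IsTest L ψ) :
    IsTest L (φ + ψ) :=
  ⟨hφ.1.add hψ.1, hφ.2.1.add hψ.2.1,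
    (tsupport_add φ ψ).trans (union_subset hφ.2.2 hψ.2.2)⟩

theorem IsTest.smul {L : ℝ} (c : ℝ) {φ : ℝ → ℝ} (hφ : IsTest L φ) : IsTest L (c • φ) :=
  ⟨hφ.1.const_smul c, hφ.2.1.smul_left (f := fun _ => c),
    (tsupport_smul_subset_right (fun _ => c) φ).trans hφ.2.2⟩

theorem isTest_zero (L : ℝ) : IsTest L 0 :=
  ⟨contDiff_const, HasCompactSupport.zero, by simp [tsupport]⟩

/-- The tuples `(φ, φ', …, φ^(m))` with `φ ∈ C_c^∞(0, L)`. -/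
def testJets (L : ℝ) (m : ℕ) : Submodule ℝ (Fin (m + 1) → L2 L) where
  carrier :=
    {J | ∃ φ, IsTest L φ ∧ ∀ k : Fin (m + 1), J k =ᵐ[intervalMeasure L] iteratedDeriv k φ}
  add_mem' := by
    rintro J K ⟨φ, hφ, hJ⟩ ⟨ψ, hψ, hK⟩
    refine ⟨φ + ψ, hφ.add hψ, fun k => ?_⟩
    filter_upwards [Lp.coeFn_add (J k) (K k), hJ k, hK k] with x h1 h2 h3
    rw [Pi.add_apply, h1, Pi.add_apply, h2, h3, iteratedDeriv_add
      ((hφ.1.of_le (by exact_mod_cast le_top)).contDiffAt)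
      ((hψ.1.of_le (by exact_mod_cast le_top)).contDiffAt)]
  zero_mem' := by
    refine ⟨0, isTest_zero L, fun k => ?_⟩
    filter_upwards [Lp.coeFn_zero ℝ 2 (intervalMeasure L)] with x h1
    simpa [iteratedDeriv_const] using h1
  smul_mem' := by
    rintro c J ⟨φ, hφ, hJ⟩
    refine ⟨c • φ, hφ.smul c, fun k => ?_⟩
    filter_upwards [Lp.coeFn_smul c (J k), hJ k] with x h1 h2
    rw [Pi.smul_apply, h1, Pi.smul_apply, h2, iteratedDeriv_const_smul
      ((hφ.1.of_le (by exact_mod_cast le_top)).contDiffAt)]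

/-- `H^m_0(0, L)`: the closure of `C_c^∞(0, L)` in `H^m(0, L)`. -/
noncomputable def H0 (L : ℝ) (m : ℕ) : Submodule ℝ (L2 L) :=
  ((testJets L m).topologicalClosure.comap (jet L m)).map (H L m).subtype

/-- The value at `x ∈ [0, L]` of (the continuous representative on `[0, L]` of) `g` is `c`. -/
def HasTrace (L : ℝ) (g : L2 L) (x c : ℝ) : Prop :=
  ∃ G : ℝ → ℝ, ContinuousOn G (Icc 0 L) ∧ g =ᵐ[intervalMeasure L] G ∧ G x = c

theorem HasTrace.add {L : ℝ} {g g' : L2 L} {x c c' : ℝ} (h : HasTrace L g x c)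
    (h' : HasTrace L g' x c') : HasTrace L (g + g') x (c + c') := by
  obtain ⟨G, hG, he, hx⟩ := h
  obtain ⟨G', hG', he', hx'⟩ := h'
  refine ⟨G + G', hG.add hG', ?_, by simp [hx, hx']⟩
  filter_upwards [Lp.coeFn_add g g', he, he'] with y h1 h2 h3
  rw [h1, Pi.add_apply, h2, h3, Pi.add_apply]

theorem HasTrace.smul {L : ℝ} {g : L2 L} {x c : ℝ} (r : ℝ) (h : HasTrace L g x c) :
    HasTrace L (r • g) x (r * c) := by
  obtain ⟨G, hG, he, hx⟩ := h
  refine ⟨r • G, hG.const_smul r, ?_, by simp [hx]⟩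
  filter_upwards [Lp.coeFn_smul r g, he] with y h1 h2
  simp [h1, h2]

theorem hasTrace_zero (L x : ℝ) : HasTrace L 0 x 0 :=
  ⟨0, continuousOn_const, Lp.coeFn_zero _ _ _, rfl⟩

/-- The linear boundary condition `u_xx(x) + γ η_xx(x) = 0`. -/
def SecondOrderBC (L γ x : ℝ) (η u : L2 L) : Prop :=
  ∃ c d : ℝ, HasTrace L (weakDeriv L 2 u) x c ∧ HasTrace L (weakDeriv L 2 η) x d ∧ c + γ * d = 0

theorem SecondOrderBC.add {L γ x : ℝ} {η u η' u' : L2 L} (hη : η ∈ H L 5) (hu : u ∈ H L 5)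
    (hη' : η' ∈ H L 5) (hu' : u' ∈ H L 5) (h : SecondOrderBC L γ x η u)
    (h' : SecondOrderBC L γ x η' u') : SecondOrderBC L γ x (η + η') (u + u') := by
  obtain ⟨c, d, hc, hd, e⟩ := h
  obtain ⟨c', d', hc', hd', e'⟩ := h'
  refine ⟨c + c', d + d', ?_, ?_, by linear_combination e + e'⟩
  · rw [weakDeriv_add (m := 5) (by norm_num) hu hu']
    exact hc.add hc'
  · rw [weakDeriv_add (m := 5) (by norm_num) hη hη']
    exact hd.add hd'

theorem SecondOrderBC.smul {L γ x : ℝ} {η u : L2 L} (r : ℝ) (hη : η ∈ H L 5) (hu : u ∈ H L 5)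
    (h : SecondOrderBC L γ x η u) : SecondOrderBC L γ x (r • η) (r • u) := by
  obtain ⟨c, d, hc, hd, e⟩ := h
  refine ⟨r * c, r * d, ?_, ?_, by linear_combination r * e⟩
  · rw [weakDeriv_smul (m := 5) (by norm_num) r hu]
    exact hc.smul r
  · rw [weakDeriv_smul (m := 5) (by norm_num) r hη]
    exact hd.smul r

theorem secondOrderBC_zero (L γ x : ℝ) : SecondOrderBC L γ x 0 0 := by
  refine ⟨0, 0, ?_, ?_, by simp⟩ <;>
  · rw [(isWeakDeriv_zero L 2).weakDeriv_eq]
    exact hasTrace_zero L x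

/-- The Hilbert space `X₀ = L²(0, L) × L²(0, L)` with its usual inner product. -/
noncomputable abbrev X0 (L : ℝ) := WithLp 2 (L2 L × L2 L)

/-- The domain of the operator: pairs `(η, u) ∈ (H⁵(0, L) ∩ H²₀(0, L))²` with
`u_xx(0) + α₁ η_xx(0) = 0` and `u_xx(L) - α₂ η_xx(L) = 0`. -/
noncomputable def domainA (L α₁ α₂ : ℝ) : Submodule ℝ (X0 L) where
  carrier := {U | U.fst ∈ H L 5 ⊓ H0 L 2 ∧ U.snd ∈ H L 5 ⊓ H0 L 2 ∧
    SecondOrderBC L α₁ 0 U.fst U.snd ∧ SecondOrderBC L (-α₂) L U.fst U.snd}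
  add_mem' := by
    rintro U V ⟨h1, h2, h3, h4⟩ ⟨k1, k2, k3, k4⟩
    exact ⟨add_mem h1 k1, add_mem h2 k2, h3.add h1.1 h2.1 k1.1 k2.1 k3,
      h4.add h1.1 h2.1 k1.1 k2.1 k4⟩
  zero_mem' := ⟨zero_mem _, zero_mem _, secondOrderBC_zero _ _ _, secondOrderBC_zero _ _ _⟩
  smul_mem' := by
    rintro c U ⟨h1, h2, h3, h4⟩
    exact ⟨Submodule.smul_mem _ c h1, Submodule.smul_mem _ c h2, h3.smul c h1.1 h2.1,
      h4.smul c h1.1 h2.1⟩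

/-- The differential expression `f ↦ -f_x + a f_xxx - b f_xxxxx`. -/
noncomputable def diffExpr (L a b : ℝ) (f : L2 L) : L2 L :=
  -weakDeriv L 1 f + a • weakDeriv L 3 f - b • weakDeriv L 5 f

theorem diffExpr_add {L a b : ℝ} {f g : L2 L} (hf : f ∈ H L 5) (hg : g ∈ H L 5) :
    diffExpr L a b (f + g) = diffExpr L a b f + diffExpr L a b g := by
  simp only [diffExpr, weakDeriv_add (m := 5) (show 1 ≤ 5 by norm_num) hf hg,
    weakDeriv_add (m := 5) (show 3 ≤ 5 by norm_num) hf hg,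
    weakDeriv_add (m := 5) le_rfl hf hg]
  module

theorem diffExpr_smul {L a b : ℝ} (c : ℝ) {f : L2 L} (hf : f ∈ H L 5) :
    diffExpr L a b (c • f) = c • diffExpr L a b f := by
  simp only [diffExpr, weakDeriv_smul (m := 5) (show 1 ≤ 5 by norm_num) c hf,
    weakDeriv_smul (m := 5) (show 3 ≤ 5 by norm_num) c hf,
    weakDeriv_smul (m := 5) le_rfl c hf]
  module

/-- The unbounded operator
`A (η, u) = (-u_x + a u_xxx - b u_xxxxx, -η_x + a η_xxx - b η_xxxxx)` in `X₀`. -/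
noncomputable def A (L a b α₁ α₂ : ℝ) : X0 L →ₗ.[ℝ] X0 L where
  domain := domainA L α₁ α₂
  toFun :=
    { toFun := fun U => WithLp.toLp 2 (diffExpr L a b (U : X0 L).snd, diffExpr L a b (U : X0 L).fst)
      map_add' := fun U V => by
        rw [← WithLp.toLp_add, Prod.mk_add_mk]
        congr 2
        · exact diffExpr_add U.2.2.1.1 V.2.2.1.1
        · exact diffExpr_add U.2.1.1 V.2.1.1
      map_smul' := fun c U => by
        rw [RingHom.id_apply, ← WithLp.toLp_smul, Prod.smul_mk]
        congr 2
        · exact diffExpr_smul c U.2.2.1.1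
        · exact diffExpr_smul c U.2.1.1 }

section Semigroups

variable {X : Type*} [NormedAddCommGroup X]

/-- `(S t)_{t ≥ 0}` is a strongly continuous one-parameter semigroup of bounded operators. -/
structure IsC0Semigroup [NormedSpace ℝ X] (S : ℝ≥0 → X →L[ℝ] X) : Prop where
  map_zero : S 0 = ContinuousLinearMap.id ℝ X
  map_add : ∀ s t, S (s + t) = (S s).comp (S t)
  tendsto_zero : ∀ x, Tendsto (fun t => S t x) (𝓝[>] 0) (𝓝 x)

/-- `T` is the infinitesimal generator of `S`: its domain consists of exactly those `x` for which
`(S t x - x) / t` converges as `t → 0+`, and `T x` is the limit. -/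
def IsGenerator [NormedSpace ℝ X] (T : X →ₗ.[ℝ] X) (S : ℝ≥0 → X →L[ℝ] X) : Prop :=
  ∀ x y, (x, y) ∈ T.graph ↔
    Tendsto (fun t : ℝ≥0 => (t : ℝ)⁻¹ • (S t x - x)) (𝓝[>] 0) (𝓝 y)

/-- `T` generates a `C₀`-semigroup of contractions. -/
def GeneratesContractionSemigroup [NormedSpace ℝ X] (T : X →ₗ.[ℝ] X) : Prop :=
  ∃ S : ℝ≥0 → X →L[ℝ] X, IsC0Semigroup S ∧ (∀ t, ‖S t‖ ≤ 1) ∧ IsGenerator T S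

/-- Dissipativity of an operator in a real Hilbert space. -/
def IsDissipative [InnerProductSpace ℝ X] (T : X →ₗ.[ℝ] X) : Prop :=
  ∀ x : T.domain, inner ℝ (T x) (x : X) ≤ 0

end Semigroups

end FifthOrderKdV

/-!
The operator is treated with the Lumer–Phillips theorem: a densely defined dissipative operator `T`
for which `1 - l T` is onto for every `l > 0` generates a `C₀`-semigroup of contractions. The
semigroup is the strong limit of the exponentials of the Yosida approximations
(`IsDissipative.generatesContractionSemigroup`). The same hypotheses make the adjoint dissipative
(`IsDissipative.adjoint`), so the adjoint of `A` never has to be computed.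

Sobolev functions are handled through the Volterra operator `(V f)(x) = ∫₀ˣ f` on `L²(0, L)`. By the
du Bois-Reymond lemma, `f` has the weak derivative `g` exactly when `f = c + V g` for a constant `c`,
which is the trace of `f` at `0`. Integration by parts is the identity `V + V* = ⟪·, 1⟫ 1`
(`inner_V_add_inner_V`), and a function with vanishing traces lies in `H²₀(0, L)` because the second
derivatives of test functions are dense in the orthogonal complement of the affine functions
(`mem_H0_two`).

* Dissipativity: for `η, u ∈ H²₀` all lower-order terms of `⟪A U, U⟫` cancel, which leaves
  `-b [u_xx η_xx]₀ᴸ = -b (α₂ η_xx(L)² + α₁ η_xx(0)²)` (`inner_diffExpr_add_inner_diffExpr`,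
  `isDissipative_A`).
* Density: pairs of test functions belong to `D(A)` (`dense_domain_A`).
* Range condition: without boundary conditions, the equation `U - l A U = F` decouples into two
  scalar equations of fifth order in the unknowns `η ± u`. These are solvable for arbitrary initial
  data, since `V` is quasi-nilpotent and hence `c - V Q` is invertible for any polynomial `Q` in `V`
  and any `c ≠ 0`. There are ten initial data and ten boundary conditions, so the uniqueness that
  dissipativity provides for the boundary value problem implies existence (`exists_sub_smul_A_eq`).
-/

namespace FifthOrderKdV

open MeasureTheory Set Filter Topology
open scoped ContDiff NNReal

/-! ### Lumer–Phillips theorem -/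

section LumerPhillips

variable {X : Type*} [NormedAddCommGroup X] [InnerProductSpace ℝ X]

theorem IsDissipative.norm_le_norm_sub {T : X →ₗ.[ℝ] X} (hT : IsDissipative T) {l : ℝ}
    (hl : 0 ≤ l) (x : T.domain) : ‖(x : X)‖ ≤ ‖(x : X) - l • T x‖ := by
  have h1 : ‖(x : X)‖ ^ 2 ≤ inner ℝ ((x : X) - l • T x) (x : X) := by
    rw [inner_sub_left, real_inner_smul_left, real_inner_self_eq_norm_sq]
    have := mul_nonneg_of_nonpos_of_nonpos (neg_nonpos.2 hl) (hT x)
    linarith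
  have h2 := h1.trans (real_inner_le_norm _ _)
  rcases eq_or_lt_of_le (norm_nonneg (x : X)) with h0 | h0
  · rw [← h0]; positivity
  · rw [sq] at h2
    exact le_of_mul_le_mul_right h2 h0

/-- `R` is the resolvent `(1 - l T)⁻¹`, everywhere defined and contractive. -/
structure IsResolvent (T : X →ₗ.[ℝ] X) (l : ℝ) (R : X →L[ℝ] X) : Prop where
  right_inv : ∀ y, ∃ x : T.domain, R y = x ∧ (x : X) - l • T x = y
  left_inv : ∀ x : T.domain, R ((x : X) - l • T x) = x
  norm_le : ∀ y, ‖R y‖ ≤ ‖y‖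

theorem IsDissipative.exists_isResolvent {T : X →ₗ.[ℝ] X} (hT : IsDissipative T) {l : ℝ}
    (hl : 0 ≤ l) (hr : ∀ y, ∃ x : T.domain, (x : X) - l • T x = y) :
    ∃ R, IsResolvent T l R := by
  choose r hr using hr
  have hinj : ∀ x x' : T.domain, (x : X) - l • T x = x' - l • T x' → x = x' := by
    intro x x' h
    have := hT.norm_le_norm_sub hl (x - x')
    rw [LinearPMap.map_sub, Submodule.coe_sub, smul_sub,
      show (x : X) - x' - (l • T x - l • T x') = (x - l • T x) - (x' - l • T x') by abel,
      h, sub_self, norm_zero, norm_le_zero_iff, sub_eq_zero] at this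
    exact Subtype.ext this
  let R₀ : X →ₗ[ℝ] X :=
    { toFun := fun y => r y
      map_add' := fun y z => by
        rw [← Submodule.coe_add]
        congr 1
        apply hinj
        rw [hr, LinearPMap.map_add, Submodule.coe_add, smul_add]
        nth_rewrite 1 [← hr y, ← hr z]
        abel
      map_smul' := fun c y => by
        rw [RingHom.id_apply, ← Submodule.coe_smul]
        congr 1
        apply hinj
        rw [hr, LinearPMap.map_smul, Submodule.coe_smul, smul_comm l c, ← smul_sub, hr] }
  have hb : ∀ y, ‖R₀ y‖ ≤ 1 * ‖y‖ := fun y => by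
    have := hT.norm_le_norm_sub hl (r y)
    rwa [hr, ← one_mul ‖y‖] at this
  refine ⟨R₀.mkContinuous 1 hb, fun y => ⟨r y, rfl, hr y⟩, fun x => ?_, fun y => ?_⟩
  · change ((r _ : T.domain) : X) = x
    rw [hinj _ _ (hr _)]
  · simpa using hb y

/-- The Yosida approximation `l⁻¹ ((1 - l T)⁻¹ - 1)` of `T`, for `R = (1 - l T)⁻¹`. -/
noncomputable def yosida (l : ℝ) (R : X →L[ℝ] X) : X →L[ℝ] X := l⁻¹ • (R - 1)

namespace IsResolvent

variable {T : X →ₗ.[ℝ] X} {l m : ℝ} {R R' : X →L[ℝ] X}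

theorem eq_of_sub_eq (h : IsResolvent T l R) {x : T.domain} {y : X}
    (e : (x : X) - l • T x = y) : R y = x := by
  rw [← e, h.left_inv]

theorem yosida_apply (h : IsResolvent T l R) (hl : 0 < l) (x : T.domain) :
    yosida l R x = R (T x) := by
  have := h.left_inv x
  rw [map_sub, map_smul] at this
  rw [yosida, smul_apply, sub_apply,
    one_apply_eq_self, inv_smul_eq_iff₀ hl.ne']
  rw [sub_eq_iff_eq_add, add_comm, ← sub_eq_iff_eq_add]
  exact this

theorem yosida_eq (h : IsResolvent T l R) (hl : 0 < l) (y : X) :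
    ∃ x : T.domain, R y = x ∧ yosida l R y = T x := by
  obtain ⟨x, h1, h2⟩ := h.right_inv y
  refine ⟨x, h1, ?_⟩
  rw [yosida, smul_apply, sub_apply,
    one_apply_eq_self, inv_smul_eq_iff₀ hl.ne', h1, sub_eq_iff_eq_add, ← h2]
  abel

theorem inner_yosida_nonpos (h : IsResolvent T l R) (hl : 0 < l) (x : X) :
    inner ℝ (yosida l R x) x ≤ 0 := by
  rw [yosida, smul_apply, sub_apply,
    one_apply_eq_self, real_inner_smul_left, inner_sub_left,
    real_inner_self_eq_norm_sq]
  refine mul_nonpos_of_nonneg_of_nonpos (by positivity) ?_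
  have h1 := real_inner_le_norm (R x) x
  have h2 := mul_le_mul_of_nonneg_right (h.norm_le x) (norm_nonneg x)
  nlinarith

/-- Resolvents of the same operator commute. -/
theorem commute (h : IsResolvent T l R) (h' : IsResolvent T m R') (hm : 0 < m) :
    Commute R R' := by
  ext y
  change R (R' y) = R' (R y)
  obtain ⟨z, hz, ez⟩ := h.right_inv y
  obtain ⟨w, hw, ew⟩ := h'.right_inv z
  have key : ((w - (l / m) • (w - z) : T.domain) : X) = w - l • T w := by
    simp only [Submodule.coe_sub, Submodule.coe_smul]
    rw [← ew, sub_sub_cancel, smul_smul, div_mul_cancel₀ _ hm.ne']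
  have h1 : R' y = w - l • T w := by
    rw [← key]
    refine h'.eq_of_sub_eq ?_
    rw [key, LinearPMap.map_sub, LinearPMap.map_smul, LinearPMap.map_sub, smul_sub, smul_smul,
      mul_div_cancel₀ _ hm.ne', ← ez, ← ew]
    module
  rw [hz, hw, h1, h.left_inv]

theorem commute_yosida (h : IsResolvent T l R) (h' : IsResolvent T m R') (hm : 0 < m) :
    Commute (yosida l R) (yosida m R') :=
  (((h.commute h' hm).sub_left (Commute.one_left _)).sub_right (Commute.one_right _)).smul_left
    _ |>.smul_right _

end IsResolvent

/-- The resolvents `(1 - lₙ T)⁻¹` converge strongly to the identity as `lₙ → 0`, because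
`‖(1 - l T)⁻¹ x - x‖ ≤ l ‖T x‖` on the dense domain of `T`. -/
theorem tendsto_resolvent {T : X →ₗ.[ℝ] X} (hd : Dense (T.domain : Set X)) {l : ℕ → ℝ}
    (hl : ∀ n, 0 < l n) (hl0 : Tendsto l atTop (𝓝 0)) {R : ℕ → X →L[ℝ] X}
    (hR : ∀ n, IsResolvent T (l n) (R n)) (x : X) :
    Tendsto (fun n => R n x) atTop (𝓝 x) := by
  have key : ∀ (z : T.domain) n, ‖R n x - x‖ ≤ 2 * ‖x - z‖ + l n * ‖T z‖ := fun z n => by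
    have e : R n x - x = R n (x - z) + (R n z - z) - (x - z) := by
      rw [map_sub]; abel
    have e2 : R n z - z = l n • R n (T z) := by
      have := (hR n).left_inv z
      rw [map_sub, map_smul] at this
      rw [sub_eq_iff_eq_add, add_comm, ← sub_eq_iff_eq_add]
      exact this
    have b2 : ‖R n z - z‖ ≤ l n * ‖T z‖ := by
      rw [e2, norm_smul, Real.norm_of_nonneg (hl n).le]
      exact mul_le_mul_of_nonneg_left ((hR n).norm_le _) (hl n).le
    have b3 := norm_sub_le (R n (x - z) + (R n z - z)) (x - z)
    have b4 := norm_add_le (R n (x - z)) (R n z - z)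
    have b5 := (hR n).norm_le (x - z)
    rw [e]
    linarith
  rw [Metric.tendsto_atTop']
  intro ε hε
  obtain ⟨z, hz, hxz⟩ := Metric.mem_closure_iff.1 (hd x) (ε / 4) (by positivity)
  rw [dist_eq_norm] at hxz
  have h1 : Tendsto (fun n => l n * ‖T ⟨z, hz⟩‖) atTop (𝓝 0) := by
    simpa using hl0.mul_const ‖T ⟨z, hz⟩‖
  obtain ⟨N, hN⟩ := eventually_atTop.1 (h1.eventually_lt_const (show 0 < ε / 2 by positivity))
  refine ⟨N, fun n hn => ?_⟩
  rw [dist_eq_norm]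
  have h2 := key ⟨z, hz⟩ n
  have h3 := hN n hn.le
  simp only at h2
  linarith

/-- The adjoint of a densely defined m-dissipative operator is dissipative: for the Yosida
approximations `Tₗ = T Rₗ` one has `⟪Rₗ V, T* V⟫ = ⟪Tₗ V, V⟫ ≤ 0`, and `Rₗ V → V`. -/
theorem IsDissipative.adjoint [CompleteSpace X] {T : X →ₗ.[ℝ] X} (hT : IsDissipative T)
    (hd : Dense (T.domain : Set X))
    (hr : ∀ l : ℝ, 0 < l → ∀ y, ∃ x : T.domain, (x : X) - l • T x = y) :
    IsDissipative T.adjoint := by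
  intro v
  have hl : ∀ n : ℕ, 0 < 1 / ((n : ℝ) + 1) := fun n => by positivity
  choose R hR using fun n => hT.exists_isResolvent (hl n).le (hr _ (hl n))
  have h1 := tendsto_resolvent hd hl tendsto_one_div_add_atTop_nhds_zero_nat hR (v : X)
  have h2 : Tendsto (fun n => inner ℝ (T.adjoint v) (R n v)) atTop
      (𝓝 (inner ℝ (T.adjoint v) (v : X))) := tendsto_const_nhds.inner h1
  refine le_of_tendsto' h2 fun n => ?_
  obtain ⟨x, hx, hx'⟩ := (hR n).yosida_eq (hl n) (v : X)
  rw [hx, LinearPMap.adjoint_isFormalAdjoint hd v x, ← hx', real_inner_comm]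
  exact (hR n).inner_yosida_nonpos (hl n) _

theorem exp_smul_apply_comm {B C : X →L[ℝ] X} (h : Commute B C) (t : ℝ) (x : X) :
    NormedSpace.exp (t • B) (C x) = C (NormedSpace.exp (t • B) x) :=
  congrArg (fun F : X →L[ℝ] X => F x) ((h.smul_left t).exp_left).eq

section Exponential

variable [CompleteSpace X]

theorem hasDerivAt_exp_smul_apply (B : X →L[ℝ] X) (x : X) (t : ℝ) :
    HasDerivAt (fun s : ℝ => NormedSpace.exp (s • B) x) (NormedSpace.exp (t • B) (B x)) t := by
  simpa using (hasDerivAt_exp_smul_const (𝕂 := ℝ) B t).clm_apply (hasDerivAt_const t x)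

/-- A bounded dissipative operator generates a semigroup of contractions. -/
theorem norm_exp_smul_apply_le {B : X →L[ℝ] X} (hB : ∀ x, inner ℝ (B x) x ≤ 0) {t : ℝ}
    (ht : 0 ≤ t) (x : X) : ‖NormedSpace.exp (t • B) x‖ ≤ ‖x‖ := by
  have hd : ∀ s : ℝ, HasDerivAt (fun s : ℝ => ‖NormedSpace.exp (s • B) x‖ ^ 2)
      (2 * inner ℝ (NormedSpace.exp (s • B) x) (NormedSpace.exp (s • B) (B x))) s :=
    fun s => (hasDerivAt_exp_smul_apply B x s).norm_sq
  have ha : Antitone (fun s : ℝ => ‖NormedSpace.exp (s • B) x‖ ^ 2) := by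
    refine antitone_of_deriv_nonpos (fun s => (hd s).differentiableAt) fun s => ?_
    rw [(hd s).deriv, exp_smul_apply_comm (Commute.refl B), real_inner_comm]
    linarith [hB (NormedSpace.exp (s • B) x)]
  have := ha ht
  simp only [zero_smul, NormedSpace.exp_zero, one_apply_eq_self] at this
  exact le_of_sq_le_sq this (norm_nonneg _)

/-- Obtained by differentiating `s ↦ exp (s B) exp ((t - s) C) x` from `0` to `t`. -/
theorem norm_exp_smul_sub_exp_smul_le {B C : X →L[ℝ] X} (h : Commute B C)
    (hB : ∀ x, inner ℝ (B x) x ≤ 0) (hC : ∀ x, inner ℝ (C x) x ≤ 0) {t : ℝ} (ht : 0 ≤ t) (x : X) :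
    ‖NormedSpace.exp (t • B) x - NormedSpace.exp (t • C) x‖ ≤ t * ‖B x - C x‖ := by
  have hd : ∀ s : ℝ, HasDerivAt
      (fun s : ℝ => NormedSpace.exp (s • B) (NormedSpace.exp ((t - s) • C) x))
      (NormedSpace.exp (s • B) (NormedSpace.exp ((t - s) • C) (B x - C x))) s := by
    intro s
    have h1 := hasDerivAt_exp_smul_const (𝕂 := ℝ) B s
    have h2 := (hasDerivAt_exp_smul_apply C x (t - s)).scomp s
      ((hasDerivAt_id s).const_sub t)
    have h3 := h1.clm_apply h2
    refine h3.congr_deriv ?_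
    simp only [Function.comp_apply, neg_smul, one_smul, map_neg, map_sub,
      mul_apply_eq_comp]
    rw [exp_smul_apply_comm h.symm, ← sub_eq_add_neg]
  have key := norm_image_sub_le_of_norm_deriv_le_segment' (a := 0) (b := t)
    (C := ‖B x - C x‖) (fun s _ => (hd s).hasDerivWithinAt)
    (fun s hs => (norm_exp_smul_apply_le hB hs.1 _).trans
      (norm_exp_smul_apply_le hC (sub_nonneg.2 hs.2.le) _)) t ⟨ht, le_rfl⟩
  simpa [mul_comm] using key

theorem norm_exp_smul_apply_sub_le {B : X →L[ℝ] X} (hB : ∀ x, inner ℝ (B x) x ≤ 0) {t : ℝ}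
    (ht : 0 ≤ t) (x : X) : ‖NormedSpace.exp (t • B) x - x‖ ≤ t * ‖B x‖ := by
  simpa using norm_exp_smul_sub_exp_smul_le (Commute.zero_right B) hB (by simp) ht x

/-- A first-order Taylor estimate for `exp (t B) x`; `y` stands for an approximation of `B x`,
and `z` for an approximation of `y` by a vector on which `B` is under control. -/
theorem norm_exp_smul_apply_sub_sub_le {B : X →L[ℝ] X} (hB : ∀ x, inner ℝ (B x) x ≤ 0) {t : ℝ}
    (ht : 0 ≤ t) (x y z : X) :
    ‖NormedSpace.exp (t • B) x - x - t • B x‖ ≤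
      t * (2 * ‖B x - y‖ + 2 * ‖y - z‖ + t * ‖B z‖) := by
  have hd : ∀ s : ℝ, HasDerivAt (fun s : ℝ => NormedSpace.exp (s • B) x - s • B x)
      (NormedSpace.exp (s • B) (B x) - B x) s := fun s => by
    have h1 := (hasDerivAt_id s).smul_const (B x)
    rw [one_smul] at h1
    exact (hasDerivAt_exp_smul_apply B x s).sub h1
  have hb : ∀ s ∈ Ico 0 t, ‖NormedSpace.exp (s • B) (B x) - B x‖ ≤
      2 * ‖B x - y‖ + 2 * ‖y - z‖ + t * ‖B z‖ := by
    intro s hs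
    have e : NormedSpace.exp (s • B) (B x) - B x =
        NormedSpace.exp (s • B) (B x - y) - (B x - y) +
        (NormedSpace.exp (s • B) (y - z) - (y - z)) + (NormedSpace.exp (s • B) z - z) := by
      simp only [map_sub]; abel
    have h1 := norm_exp_smul_apply_le hB hs.1 (B x - y)
    have h2 := norm_exp_smul_apply_le hB hs.1 (y - z)
    have h3 := norm_exp_smul_apply_sub_le hB hs.1 z
    have h4 := mul_le_mul_of_nonneg_right hs.2.le (norm_nonneg (B z))
    have h5 := norm_sub_le (NormedSpace.exp (s • B) (B x - y)) (B x - y)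
    have h6 := norm_sub_le (NormedSpace.exp (s • B) (y - z)) (y - z)
    rw [e]
    refine (norm_add₃_le).trans ?_
    linarith
  have key := norm_image_sub_le_of_norm_deriv_le_segment' (a := 0) (b := t)
    (fun s _ => (hd s).hasDerivWithinAt) hb t ⟨ht, le_rfl⟩
  simp only [zero_smul, NormedSpace.exp_zero, one_apply_eq_self, sub_zero] at key
  rw [sub_right_comm, mul_comm t]
  exact key

/-- If commuting bounded dissipative operators `Bₙ` converge on a dense set, the semigroups they
generate converge strongly. -/
theorem exists_tendsto_exp_smul {B : ℕ → X →L[ℝ] X} (hB : ∀ n x, inner ℝ (B n x) x ≤ 0)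
    (hc : ∀ m n, Commute (B m) (B n)) {D : Set X} (hD : Dense D)
    (hconv : ∀ x ∈ D, CauchySeq fun n => B n x) :
    ∃ S : ℝ≥0 → X →L[ℝ] X, (∀ t x, ‖S t x‖ ≤ ‖x‖) ∧
      ∀ (t : ℝ≥0) x, Tendsto (fun n => NormedSpace.exp ((t : ℝ) • B n) x) atTop (𝓝 (S t x)) := by
  have hcs : ∀ (t : ℝ≥0) (x : X), CauchySeq fun n => NormedSpace.exp ((t : ℝ) • B n) x := by
    intro t x
    rw [Metric.cauchySeq_iff']
    intro ε hε
    obtain ⟨z, hz, hxz⟩ := Metric.mem_closure_iff.1 (hD x) (ε / 4) (by positivity)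
    rw [dist_eq_norm] at hxz
    obtain ⟨N, hN⟩ := Metric.cauchySeq_iff'.1 (hconv z hz) (ε / (2 * (t + 1))) (by positivity)
    refine ⟨N, fun n hn => ?_⟩
    have h1 := hN n hn
    rw [dist_eq_norm] at h1 ⊢
    have h2 := norm_exp_smul_sub_exp_smul_le (hc n N) (hB n) (hB N) t.2 z
    have h3 : (t : ℝ) * ‖B n z - B N z‖ ≤ ε / 2 := by
      calc (t : ℝ) * ‖B n z - B N z‖ ≤ (t + 1) * (ε / (2 * (t + 1))) :=
            mul_le_mul (by linarith) h1.le (norm_nonneg _) (by positivity)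
        _ = ε / 2 := by field_simp
    have h4 := norm_exp_smul_apply_le (hB n) t.2 (x - z)
    have h5 := norm_exp_smul_apply_le (hB N) t.2 (x - z)
    have e : NormedSpace.exp ((t : ℝ) • B n) x - NormedSpace.exp ((t : ℝ) • B N) x =
        NormedSpace.exp ((t : ℝ) • B n) (x - z) - NormedSpace.exp ((t : ℝ) • B N) (x - z) +
        (NormedSpace.exp ((t : ℝ) • B n) z - NormedSpace.exp ((t : ℝ) • B N) z) := by
      simp only [map_sub]; abel
    have h6 := norm_sub_le (NormedSpace.exp ((t : ℝ) • B n) (x - z))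
      (NormedSpace.exp ((t : ℝ) • B N) (x - z))
    rw [e]
    refine (norm_add_le _ _).trans_lt ?_
    simp only [NNReal.val_eq_coe] at *
    linarith
  choose S hS using fun (t : ℝ≥0) x => cauchySeq_tendsto_of_complete (hcs t x)
  have hn : ∀ t x, ‖S t x‖ ≤ ‖x‖ := fun t x =>
    le_of_tendsto' (hS t x).norm fun n => norm_exp_smul_apply_le (hB n) t.2 x
  refine ⟨fun t => LinearMap.mkContinuous
    { toFun := S t
      map_add' := fun x y => tendsto_nhds_unique (hS t (x + y)) (by
        simpa using (hS t x).add (hS t y))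
      map_smul' := fun c x => tendsto_nhds_unique (hS t (c • x)) (by
        simpa using (hS t x).const_smul c) } 1 (fun x => by simpa using hn t x), hn, hS⟩

end Exponential

/-- Domains of generators of contraction semigroups are maximal: only the zero vector can be its
own generator value, as `⟪S t w - w, w⟫ ≤ 0`. -/
theorem eq_zero_of_tendsto_self {S : ℝ≥0 → X →L[ℝ] X} (hn : ∀ t x, ‖S t x‖ ≤ ‖x‖) {w : X}
    (h : Tendsto (fun t : ℝ≥0 => (t : ℝ)⁻¹ • (S t w - w)) (𝓝[>] 0) (𝓝 w)) : w = 0 := by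
  have h1 : Tendsto (fun t : ℝ≥0 => inner ℝ ((t : ℝ)⁻¹ • (S t w - w)) w) (𝓝[>] 0)
      (𝓝 (inner ℝ w w)) := h.inner tendsto_const_nhds
  have h2 : inner ℝ w w ≤ 0 := by
    refine le_of_tendsto' h1 fun t => ?_
    rw [real_inner_smul_left, inner_sub_left, real_inner_self_eq_norm_sq]
    refine mul_nonpos_of_nonneg_of_nonpos (by positivity) ?_
    have h3 := real_inner_le_norm (S t w) w
    have h4 := mul_le_mul_of_nonneg_right (hn t w) (norm_nonneg w)
    nlinarith
  exact real_inner_self_nonpos.1 h2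

/-- The **Lumer–Phillips theorem** in a Hilbert space: a densely defined dissipative operator `T`
with `1 - l T` onto for every `l > 0` generates a `C₀`-semigroup of contractions. -/
theorem IsDissipative.generatesContractionSemigroup [CompleteSpace X] {T : X →ₗ.[ℝ] X}
    (hT : IsDissipative T) (hd : Dense (T.domain : Set X))
    (hr : ∀ l : ℝ, 0 < l → ∀ y, ∃ x : T.domain, (x : X) - l • T x = y) :
    GeneratesContractionSemigroup T := by
  have hl : ∀ n : ℕ, 0 < 1 / ((n : ℝ) + 1) := fun n => by positivity
  choose R hR using fun n => hT.exists_isResolvent (hl n).le (hr _ (hl n))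
  have hR1 := tendsto_resolvent hd hl tendsto_one_div_add_atTop_nhds_zero_nat hR
  set B : ℕ → X →L[ℝ] X := fun n => yosida (1 / ((n : ℝ) + 1)) (R n)
  have hB : ∀ n x, inner ℝ (B n x) x ≤ 0 := fun n => (hR n).inner_yosida_nonpos (hl n)
  have hBT : ∀ x : T.domain, Tendsto (fun n => B n x) atTop (𝓝 (T x)) := fun x => by
    simpa only [B, (hR _).yosida_apply (hl _)] using hR1 (T x)
  obtain ⟨S, hS, hlim⟩ := exists_tendsto_exp_smul hB
    (fun m n => (hR m).commute_yosida (hR n) (hl n)) hd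
    (fun x hx => (hBT ⟨x, hx⟩).cauchySeq)
  -- the Taylor estimate passes to the limit
  have htaylor : ∀ (t : ℝ≥0) (x z : T.domain),
      ‖S t x - x - (t : ℝ) • T x‖ ≤ t * (2 * ‖T x - z‖ + t * ‖T z‖) := by
    intro t x z
    have h1 : Tendsto (fun n => (t : ℝ) * (2 * ‖B n x - T x‖ + 2 * ‖T x - z‖ + t * ‖B n z‖)) atTop
        (𝓝 (t * (2 * ‖T x - T x‖ + 2 * ‖T x - z‖ + t * ‖T z‖))) :=
      (((((hBT x).sub_const _).norm.const_mul 2).add_const _).add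
        ((hBT z).norm.const_mul _)).const_mul _
    have h2 := le_of_tendsto_of_tendsto'
      (((hlim t x).sub_const (x : X)).sub ((hBT x).const_smul (t : ℝ))).norm h1
      (fun n => norm_exp_smul_apply_sub_sub_le (hB n) t.2 x (T x) z)
    simpa using h2
  have hgen : ∀ x : T.domain,
      Tendsto (fun t : ℝ≥0 => (t : ℝ)⁻¹ • (S t x - x)) (𝓝[>] 0) (𝓝 (T x)) := by
    intro x
    rw [Metric.tendsto_nhds]
    intro ε hε
    obtain ⟨z, hz, hxz⟩ := Metric.mem_closure_iff.1 (hd (T x)) (ε / 4) (by positivity)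
    rw [dist_eq_norm] at hxz
    have h1 : Tendsto (fun t : ℝ≥0 => (t : ℝ) * ‖T ⟨z, hz⟩‖) (𝓝[>] 0) (𝓝 0) := by
      have : Continuous fun t : ℝ≥0 => (t : ℝ) * ‖T ⟨z, hz⟩‖ := by fun_prop
      simpa using (this.tendsto 0).mono_left nhdsWithin_le_nhds
    filter_upwards [h1.eventually_lt_const (show 0 < ε / 2 by positivity), self_mem_nhdsWithin]
      with t ht ht0
    have ht0' : (0 : ℝ) < t := by exact_mod_cast ht0
    have h2 := htaylor t x ⟨z, hz⟩
    have e : (t : ℝ)⁻¹ • (S t x - x) - T x = (t : ℝ)⁻¹ • (S t x - x - (t : ℝ) • T x) := by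
      rw [smul_sub _ (S t x - (x : X)), inv_smul_smul₀ ht0'.ne']
    rw [dist_eq_norm, e, norm_smul, norm_inv, Real.norm_of_nonneg ht0'.le]
    calc (t : ℝ)⁻¹ * ‖S t x - x - (t : ℝ) • T x‖
        ≤ (t : ℝ)⁻¹ * (t * (2 * ‖T x - z‖ + t * ‖T ⟨z, hz⟩‖)) := by gcongr
      _ = 2 * ‖T x - z‖ + t * ‖T ⟨z, hz⟩‖ := by field_simp
      _ < ε := by linarith
  refine ⟨S, ⟨?_, ?_, ?_⟩, fun t => ContinuousLinearMap.opNorm_le_bound _ zero_le_one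
    (by simpa using hS t), fun x y => ⟨?_, fun h => ?_⟩⟩
  · ext x
    refine tendsto_nhds_unique (hlim 0 x) ?_
    simp
  · intro s t
    ext x
    let _ : NormedAlgebra ℚ (X →L[ℝ] X) := .restrictScalars ℚ ℝ (X →L[ℝ] X)
    refine tendsto_nhds_unique (hlim (s + t) x) ?_
    have h1 : Tendsto (fun n => NormedSpace.exp ((s : ℝ) • B n)
        (NormedSpace.exp ((t : ℝ) • B n) x - S t x)) atTop (𝓝 0) := by
      refine squeeze_zero_norm (fun n => norm_exp_smul_apply_le (hB n) s.2 _) ?_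
      simpa using ((hlim t x).sub_const (S t x)).norm
    have h2 := h1.add (hlim s (S t x))
    rw [zero_add] at h2
    refine h2.congr fun n => ?_
    rw [map_sub, sub_add_cancel, NNReal.coe_add, add_smul,
      NormedSpace.exp_add_of_commute
        (((Commute.refl (B n)).smul_left _).smul_right _)]
    rfl
  · intro x
    have key : ∀ (t : ℝ≥0) (z : T.domain), ‖S t x - x‖ ≤ 2 * ‖x - z‖ + t * ‖T z‖ := by
      intro t z
      have h1 : ‖S t z - z‖ ≤ t * ‖T z‖ :=
        le_of_tendsto_of_tendsto' ((hlim t z).sub_const (z : X)).norm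
          ((hBT z).norm.const_mul _) fun n => norm_exp_smul_apply_sub_le (hB n) t.2 _
      have e : S t x - x = S t (x - z) + (S t z - z) - (x - z) := by
        rw [map_sub]; abel
      have b3 := norm_sub_le (S t (x - z) + (S t z - z)) (x - z)
      have b4 := norm_add_le (S t (x - z)) (S t z - z)
      have b5 := hS t (x - z)
      rw [e]
      linarith
    rw [Metric.tendsto_nhds]
    intro ε hε
    obtain ⟨z, hz, hxz⟩ := Metric.mem_closure_iff.1 (hd x) (ε / 4) (by positivity)
    rw [dist_eq_norm] at hxz
    have h1 : Tendsto (fun t : ℝ≥0 => (t : ℝ) * ‖T ⟨z, hz⟩‖) (𝓝[>] 0) (𝓝 0) := by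
      have : Continuous fun t : ℝ≥0 => (t : ℝ) * ‖T ⟨z, hz⟩‖ := by fun_prop
      simpa using (this.tendsto 0).mono_left nhdsWithin_le_nhds
    filter_upwards [h1.eventually_lt_const (show 0 < ε / 2 by positivity)] with t ht
    have h2 := key t ⟨z, hz⟩
    rw [dist_eq_norm]
    simp only at h2
    linarith
  · intro h
    obtain ⟨z, hz, hz'⟩ := (LinearPMap.mem_graph_iff T).1 h
    simp only at hz hz'
    rw [← hz, ← hz']
    exact hgen z
  · obtain ⟨z, hz⟩ := hr 1 one_pos (x - y)
    rw [one_smul] at hz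
    have e : x - z = y - T z := by
      rw [sub_eq_sub_iff_sub_eq_sub, hz]
    have h1 : Tendsto (fun t : ℝ≥0 => (t : ℝ)⁻¹ • (S t (x - z) - (x - z))) (𝓝[>] 0)
        (𝓝 (x - z)) := by
      rw [e]
      refine (h.sub (hgen z)).congr fun t => ?_
      rw [← smul_sub, ← e, map_sub]
      congr 1
      abel
    have h2 := eq_zero_of_tendsto_self hS h1
    rw [LinearPMap.mem_graph_iff]
    exact ⟨z, (sub_eq_zero.1 h2).symm, (sub_eq_zero.1 (e.symm.trans h2)).symm⟩

end LumerPhillips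

/-! ### The Volterra operator -/

section Volterra

variable {L : ℝ}

theorem inner_eq_integral (f g : L2 L) : inner ℝ f g = ∫ x in Ioo 0 L, f x * g x := by
  rw [L2.inner_def]
  refine integral_congr_ae (Eventually.of_forall fun x => ?_)
  simp [mul_comm]

theorem inner_eq_intervalIntegral (hL : 0 < L) {f g : L2 L} {F G : ℝ → ℝ}
    (hF : f =ᵐ[intervalMeasure L] F) (hG : g =ᵐ[intervalMeasure L] G) :
    inner ℝ f g = ∫ x in 0..L, F x * G x := by
  rw [inner_eq_integral, intervalIntegral.integral_of_le hL.le, integral_Ioc_eq_integral_Ioo]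
  refine integral_congr_ae ?_
  filter_upwards [hF, hG] with x h1 h2
  rw [h1, h2]

/-- The constant function `1` on `(0, L)`. -/
noncomputable def one (L : ℝ) : L2 L := Lp.const 2 (intervalMeasure L) (1 : ℝ)

theorem coeFn_one : (one L : ℝ → ℝ) =ᵐ[intervalMeasure L] fun _ => 1 :=
  Lp.coeFn_const 2 (intervalMeasure L) (1 : ℝ)

theorem inner_one (hL : 0 < L) (f : L2 L) : inner ℝ f (one L) = ∫ x in 0..L, f x := by
  simpa using inner_eq_intervalIntegral hL (ae_eq_refl f) coeFn_one

theorem inner_one_one (hL : 0 < L) : inner ℝ (one L) (one L) = L := by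
  simpa using inner_eq_intervalIntegral hL coeFn_one coeFn_one

theorem integrableOn_Ioo (f : L2 L) : IntegrableOn f (Ioo 0 L) :=
  (Lp.memLp f).integrable (by norm_num)

theorem intervalIntegrable_coe (hL : 0 < L) (f : L2 L) : IntervalIntegrable f volume 0 L := by
  rw [intervalIntegrable_iff_integrableOn_Ioo_of_le hL.le]
  exact integrableOn_Ioo f

theorem intervalIntegrable_coe' (f : L2 L) {x : ℝ} (hx : x ∈ Icc 0 L) :
    IntervalIntegrable f volume 0 x := by
  rw [intervalIntegrable_iff_integrableOn_Ioo_of_le hx.1]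
  exact (integrableOn_Ioo f).mono_set (Ioo_subset_Ioo_right hx.2)

theorem intervalIntegral_congr_ae_of_mem {f g : ℝ → ℝ} (h : f =ᵐ[intervalMeasure L] g) {x : ℝ}
    (hx : x ∈ Icc 0 L) : ∫ t in 0..x, f t = ∫ t in 0..x, g t := by
  rw [intervalIntegral.integral_of_le hx.1, intervalIntegral.integral_of_le hx.1,
    integral_Ioc_eq_integral_Ioo, integral_Ioc_eq_integral_Ioo]
  exact integral_congr_ae (ae_restrict_of_ae_restrict_of_subset (Ioo_subset_Ioo_right hx.2) h)

/-- The primitive of `f ∈ L²(0, L)` that vanishes at `0`. It is meaningful on `[0, L]` only. -/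
noncomputable def prim (f : L2 L) (x : ℝ) : ℝ := ∫ t in 0..x, f t

theorem continuousOn_prim (hL : 0 < L) (f : L2 L) : ContinuousOn (prim f) (Icc 0 L) := by
  have := intervalIntegral.continuousOn_primitive_interval
    (μ := volume) (f := f) (a := 0) (b := L) (by
      rw [uIcc_of_le hL.le, integrableOn_Icc_iff_integrableOn_Ioo]
      exact integrableOn_Ioo f)
  rwa [uIcc_of_le hL.le] at this

theorem abs_prim_le (f : L2 L) {x : ℝ} (hx : x ∈ Icc 0 L) :
    |prim f x| ≤ ‖one L‖ * ‖f‖ := by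
  have h1 : |prim f x| ≤ ∫ t in Ioo 0 L, |f t| := by
    rw [prim, intervalIntegral.integral_of_le hx.1, integral_Ioc_eq_integral_Ioo]
    refine (abs_integral_le_integral_abs).trans ?_
    exact setIntegral_mono_set (integrableOn_Ioo f).abs
      (Eventually.of_forall fun t => abs_nonneg _) (Ioo_subset_Ioo_right hx.2).eventuallyLE
  have h2 : ∫ t in Ioo 0 L, |f t| = inner ℝ (one L) |f| := by
    rw [inner_eq_integral]
    refine integral_congr_ae ?_
    filter_upwards [coeFn_one (L := L), Lp.coeFn_abs f] with t e1 e2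
    rw [e1, e2, one_mul]
  rw [h2] at h1
  refine h1.trans ((real_inner_le_norm _ _).trans ?_)
  rw [norm_abs_eq_norm]

theorem memLp_prim (f : L2 L) : MemLp (prim f) 2 (intervalMeasure L) := by
  rcases le_or_gt L 0 with hL | hL
  · have : intervalMeasure L = 0 := by
      rw [intervalMeasure, Ioo_eq_empty (by simpa using hL), Measure.restrict_empty]
    rw [this]
    exact memLp_measure_zero
  · refine MemLp.of_bound (((continuousOn_prim hL f).mono Ioo_subset_Icc_self).aestronglyMeasurable
      measurableSet_Ioo) (‖one L‖ * ‖f‖) ?_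
    filter_upwards [ae_restrict_mem measurableSet_Ioo] with x hx
    exact abs_prim_le f (Ioo_subset_Icc_self hx)

/-- The Volterra operator `(V f)(x) = ∫₀ˣ f` on `L²(0, L)`. -/
noncomputable def V (L : ℝ) : L2 L →L[ℝ] L2 L :=
  LinearMap.mkContinuous
    { toFun := fun f => (memLp_prim f).toLp
      map_add' := fun f g => by
        rw [← MemLp.toLp_add, MemLp.toLp_eq_toLp_iff]
        filter_upwards [ae_restrict_mem measurableSet_Ioo] with x hx
        have hx' := Ioo_subset_Icc_self hx
        rw [Pi.add_apply, prim, intervalIntegral_congr_ae_of_mem (Lp.coeFn_add f g) hx']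
        exact intervalIntegral.integral_add (intervalIntegrable_coe' f hx')
          (intervalIntegrable_coe' g hx')
      map_smul' := fun c f => by
        rw [RingHom.id_apply, ← MemLp.toLp_const_smul, MemLp.toLp_eq_toLp_iff]
        filter_upwards [ae_restrict_mem measurableSet_Ioo] with x hx
        have hx' := Ioo_subset_Icc_self hx
        rw [Pi.smul_apply, prim, intervalIntegral_congr_ae_of_mem (Lp.coeFn_smul c f) hx']
        exact intervalIntegral.integral_smul c f }
    ((measureUnivNNReal (intervalMeasure L) : ℝ) ^ (2 : ENNReal).toReal⁻¹ * ‖one L‖)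
    fun f => by
      rw [mul_assoc]
      refine Lp.norm_le_of_ae_bound (by positivity) ?_
      filter_upwards [(memLp_prim f).coeFn_toLp, ae_restrict_mem measurableSet_Ioo] with x h1 hx
      change ‖(memLp_prim f).toLp _ x‖ ≤ _
      rw [h1]
      exact abs_prim_le f (Ioo_subset_Icc_self hx)

theorem coeFn_V (f : L2 L) : V L f =ᵐ[intervalMeasure L] prim f :=
  (memLp_prim f).coeFn_toLp

theorem V_eq_of_ae {f g : L2 L} {F : ℝ → ℝ} (hg : g =ᵐ[intervalMeasure L] F)
    (h : ∀ x ∈ Ioo 0 L, prim f x = F x) : V L f = g := by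
  refine Lp.ext ?_
  filter_upwards [coeFn_V f, hg, ae_restrict_mem measurableSet_Ioo] with x h1 h2 h3
  rw [h1, h2, h x h3]

/-- Integration by parts, in terms of the Volterra operator. -/
theorem inner_V_add_inner_V (hL : 0 < L) (f g : L2 L) :
    inner ℝ (V L f) g + inner ℝ f (V L g) = inner ℝ f (one L) * inner ℝ g (one L) := by
  have hf := intervalIntegrable_coe hL f
  have hg := intervalIntegrable_coe hL g
  have key := (hf.absolutelyContinuousOnInterval_intervalIntegral
    (c := 0) left_mem_uIcc).integral_mul_deriv_eq_deriv_mul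
    (hg.absolutelyContinuousOnInterval_intervalIntegral (c := 0) left_mem_uIcc)
  have hd : ∀ f : L2 L, ∀ᵐ x, x ∈ uIoc 0 L → deriv (fun x => ∫ t in 0..x, f t) x = f x :=
    fun f => by
      filter_upwards [(intervalIntegrable_coe hL f).ae_hasDerivAt_integral] with x hx hx'
      exact (hx (uIoc_subset_uIcc hx') 0 left_mem_uIcc).deriv
  have e1 : ∫ x in 0..L, (∫ t in 0..x, f t) * deriv (fun x => ∫ t in 0..x, g t) x =
      inner ℝ (V L f) g := by
    rw [inner_eq_intervalIntegral hL (coeFn_V f) (ae_eq_refl g)]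
    refine intervalIntegral.integral_congr_ae ?_
    filter_upwards [hd g] with x hx hx'
    rw [hx hx', prim]
  have e2 : ∫ x in 0..L, deriv (fun x => ∫ t in 0..x, f t) x * (∫ t in 0..x, g t) =
      inner ℝ f (V L g) := by
    rw [inner_eq_intervalIntegral hL (ae_eq_refl f) (coeFn_V g)]
    refine intervalIntegral.integral_congr_ae ?_
    filter_upwards [hd f] with x hx hx'
    rw [hx hx', prim]
  rw [e1, e2, intervalIntegral.integral_same, zero_mul, sub_zero] at key
  rw [inner_one hL, inner_one hL, key]
  ring

/-- The iterates of `V` are controlled by Taylor coefficients. -/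
theorem abs_V_pow_succ_le (f : L2 L) (n : ℕ) : ∀ᵐ x ∂intervalMeasure L,
    |((V L) ^ (n + 1)) f x| ≤ ‖one L‖ * ‖f‖ * (x ^ n / n.factorial) := by
  induction n with
  | zero =>
    filter_upwards [coeFn_V f, ae_restrict_mem measurableSet_Ioo] with x h1 hx
    simpa [h1] using abs_prim_le f (Ioo_subset_Icc_self hx)
  | succ n ih =>
    rw [pow_succ', mul_apply_eq_comp]
    filter_upwards [coeFn_V (((V L) ^ (n + 1)) f), ae_restrict_mem measurableSet_Ioo] with x h1 hx
    rw [h1, prim]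
    have hc : Continuous fun t : ℝ => ‖one L‖ * ‖f‖ * (t ^ n / n.factorial) := by fun_prop
    have h2 := intervalIntegral.norm_integral_le_of_norm_le (μ := volume) hx.1.le
      (f := ((V L) ^ (n + 1)) f) (g := fun t => ‖one L‖ * ‖f‖ * (t ^ n / n.factorial)) (by
        have h3 := (ae_restrict_iff' measurableSet_Ioo).1 ih
        filter_upwards [h3] with t ht ht'
        exact ht ⟨ht'.1, ht'.2.trans_lt hx.2⟩) (hc.intervalIntegrable 0 x)
    rw [Real.norm_eq_abs] at h2
    refine h2.trans_eq ?_
    rw [intervalIntegral.integral_const_mul, intervalIntegral.integral_div, integral_pow,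
      Nat.factorial_succ]
    push_cast
    have : (n.factorial : ℝ) ≠ 0 := by positivity
    field_simp
    ring

theorem norm_V_pow_succ_le (hL : 0 < L) : ∃ K : ℝ, 0 ≤ K ∧
    ∀ n : ℕ, ‖(V L) ^ (n + 1)‖ ≤ K * (L ^ n / n.factorial) := by
  refine ⟨(measureUnivNNReal (intervalMeasure L) : ℝ) ^ (2 : ENNReal).toReal⁻¹ * ‖one L‖,
    by positivity, fun n => ContinuousLinearMap.opNorm_le_bound _ (by positivity) fun f => ?_⟩
  have := Lp.norm_le_of_ae_bound (f := ((V L) ^ (n + 1)) f) (p := 2)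
    (C := ‖one L‖ * ‖f‖ * (L ^ n / n.factorial)) (by positivity) (by
      filter_upwards [abs_V_pow_succ_le f n, ae_restrict_mem measurableSet_Ioo] with x h1 hx
      refine h1.trans ?_
      have := pow_le_pow_left₀ hx.1.le hx.2.le n
      gcongr)
  refine this.trans_eq ?_
  ring

theorem isUnit_one_sub_of_norm_pow_lt_one {R : Type*} [NormedRing R] [CompleteSpace R] {x : R}
    {n : ℕ} (h : ‖x ^ n‖ < 1) : IsUnit (1 - x) := by
  have h1 := isUnit_one_sub_of_norm_lt_one h
  rw [← mul_neg_geom_sum] at h1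
  refine ((Commute.isUnit_mul_iff ?_).1 h1).1
  exact (Commute.one_left _).sub_left
    (Commute.sum_right _ _ _ fun i _ => (Commute.refl x).pow_right i)

/-- The Volterra operator is quasi-nilpotent, so that `c - V Q` is invertible for every `Q`
commuting with `V` and every `c ≠ 0`. -/
theorem isUnit_smul_one_sub_V_mul (hL : 0 < L) {Q : L2 L →L[ℝ] L2 L} (hQ : Commute (V L) Q)
    {c : ℝ} (hc : c ≠ 0) : IsUnit (c • (1 : L2 L →L[ℝ] L2 L) - V L * Q) := by
  obtain ⟨K, hK, hV⟩ := norm_V_pow_succ_le hL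
  set P := c⁻¹ • Q
  have hP : Commute (V L) P := hQ.smul_right _
  have hlim : Tendsto (fun n : ℕ => K * ‖P‖ * ((L * ‖P‖) ^ n / n.factorial)) atTop (𝓝 0) := by
    simpa using (FloorSemiring.tendsto_pow_div_factorial_atTop (L * ‖P‖)).const_mul (K * ‖P‖)
  obtain ⟨n, hn⟩ := (hlim.eventually_lt_const zero_lt_one).exists
  have h1 : ‖(V L * P) ^ (n + 1)‖ < 1 := by
    refine lt_of_le_of_lt ?_ hn
    rw [hP.mul_pow]
    refine (norm_mul_le _ _).trans ?_
    calc ‖V L ^ (n + 1)‖ * ‖P ^ (n + 1)‖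
        ≤ K * (L ^ n / n.factorial) * ‖P‖ ^ (n + 1) :=
          mul_le_mul (hV n) (norm_pow_le' _ n.succ_pos) (norm_nonneg _) (by positivity)
      _ = K * ‖P‖ * ((L * ‖P‖) ^ n / n.factorial) := by ring
  have h2 := isUnit_one_sub_of_norm_pow_lt_one h1
  have e : c • (1 : L2 L →L[ℝ] L2 L) - V L * Q = c • (1 - V L * P) := by
    rw [smul_sub, mul_smul_comm, smul_inv_smul₀ hc]
  rw [e]
  exact (isUnit_smul_iff (Units.mk0 c hc) _).2 h2

end Volterra

/-! ### Weak derivatives and the du Bois-Reymond lemma -/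

section WeakDerivatives

variable {L : ℝ}

theorem iteratedDeriv_iteratedDeriv (j k : ℕ) (φ : ℝ → ℝ) :
    iteratedDeriv j (iteratedDeriv k φ) = iteratedDeriv (j + k) φ := by
  simp only [iteratedDeriv_eq_iterate, Function.iterate_add_apply]

theorem IsTest.iteratedDeriv {φ : ℝ → ℝ} (hφ : IsTest L φ) (k : ℕ) :
    IsTest L (iteratedDeriv k φ) := by
  induction k with
  | zero => simpa using hφ
  | succ k ih =>
    rw [iteratedDeriv_succ]
    exact ⟨(contDiff_infty_iff_deriv.1 ih.1).2, ih.2.1.deriv,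
      (closure_minimal (support_deriv_subset) (isClosed_tsupport _)).trans ih.2.2⟩

theorem IsTest.eq_zero {φ : ℝ → ℝ} (hφ : IsTest L φ) {x : ℝ} (hx : x ∉ Ioo 0 L) : φ x = 0 :=
  image_eq_zero_of_notMem_tsupport fun h => hx (hφ.2.2 h)

/-- The `k`-th derivative of a test function as an element of `L²(0, L)`. -/
noncomputable def IsTest.toL2 {φ : ℝ → ℝ} (hφ : IsTest L φ) (k : ℕ) : L2 L :=
  (hφ.memLp_iteratedDeriv k).toLp

theorem IsTest.coeFn_toL2 {φ : ℝ → ℝ} (hφ : IsTest L φ) (k : ℕ) :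
    hφ.toL2 k =ᵐ[intervalMeasure L] _root_.iteratedDeriv k φ :=
  (hφ.memLp_iteratedDeriv k).coeFn_toLp

theorem IsTest.inner_toL2 {φ : ℝ → ℝ} (hφ : IsTest L φ) (k : ℕ) (f : L2 L) :
    inner ℝ f (hφ.toL2 k) = ∫ x in Ioo 0 L, f x * _root_.iteratedDeriv k φ x := by
  rw [inner_eq_integral]
  refine integral_congr_ae ?_
  filter_upwards [hφ.coeFn_toL2 k] with x hx
  rw [hx]

theorem IsTest.toL2_add {φ ψ : ℝ → ℝ} (hφ : IsTest L φ) (hψ : IsTest L ψ) (k : ℕ) :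
    (hφ.add hψ).toL2 k = hφ.toL2 k + hψ.toL2 k := by
  refine Lp.ext ?_
  filter_upwards [(hφ.add hψ).coeFn_toL2 k, hφ.coeFn_toL2 k, hψ.coeFn_toL2 k,
    Lp.coeFn_add (hφ.toL2 k) (hψ.toL2 k)] with x e1 e2 e3 e4
  rw [e1, e4, Pi.add_apply, e2, e3, iteratedDeriv_add
    ((hφ.1.of_le (by exact_mod_cast le_top)).contDiffAt)
    ((hψ.1.of_le (by exact_mod_cast le_top)).contDiffAt)]

theorem IsTest.toL2_smul (c : ℝ) {φ : ℝ → ℝ} (hφ : IsTest L φ) (k : ℕ) :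
    (hφ.smul c).toL2 k = c • hφ.toL2 k := by
  refine Lp.ext ?_
  filter_upwards [(hφ.smul c).coeFn_toL2 k, hφ.coeFn_toL2 k, Lp.coeFn_smul c (hφ.toL2 k)]
    with x e1 e2 e3
  rw [e1, e3, Pi.smul_apply, e2, iteratedDeriv_const_smul
    ((hφ.1.of_le (by exact_mod_cast le_top)).contDiffAt)]

theorem toL2_zero (L : ℝ) (k : ℕ) : (isTest_zero L).toL2 k = 0 := by
  refine Lp.ext ?_
  filter_upwards [(isTest_zero L).coeFn_toL2 k, Lp.coeFn_zero ℝ 2 (intervalMeasure L)]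
    with x e1 e2
  rw [e1, e2]
  simp

theorem isWeakDeriv_iff {k : ℕ} {f g : L2 L} :
    IsWeakDeriv L k f g ↔ ∀ φ (hφ : IsTest L φ),
      inner ℝ f (hφ.toL2 k) = (-1) ^ k * inner ℝ g (hφ.toL2 0) := by
  simp only [IsTest.inner_toL2, iteratedDeriv_zero]
  rfl

theorem IsTest.intervalIntegral_iteratedDeriv_succ {φ : ℝ → ℝ} (hφ : IsTest L φ) (k : ℕ) (x : ℝ) :
    ∫ t in 0..x, _root_.iteratedDeriv (k + 1) φ t = _root_.iteratedDeriv k φ x := by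
  have h1 := (hφ.iteratedDeriv k).1
  rw [iteratedDeriv_succ, intervalIntegral.integral_deriv_eq_sub
    (fun y _ => (h1.differentiable (by simp)).differentiableAt)
    ((h1.continuous_deriv (by simp)).intervalIntegrable _ _),
    (hφ.iteratedDeriv k).eq_zero (x := 0) (by simp), sub_zero]

theorem IsTest.V_toL2_succ {φ : ℝ → ℝ} (hφ : IsTest L φ) (k : ℕ) :
    V L (hφ.toL2 (k + 1)) = hφ.toL2 k :=
  V_eq_of_ae (hφ.coeFn_toL2 k) fun x hx => by
    rw [prim, intervalIntegral_congr_ae_of_mem (hφ.coeFn_toL2 (k + 1)) (Ioo_subset_Icc_self hx),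
      hφ.intervalIntegral_iteratedDeriv_succ]

theorem IsTest.inner_toL2_succ_one (hL : 0 < L) {φ : ℝ → ℝ} (hφ : IsTest L φ) (k : ℕ) :
    inner ℝ (hφ.toL2 (k + 1)) (one L) = 0 := by
  rw [inner_one hL, intervalIntegral_congr_ae_of_mem (hφ.coeFn_toL2 (k + 1)) ⟨hL.le, le_rfl⟩,
    hφ.intervalIntegral_iteratedDeriv_succ, (hφ.iteratedDeriv k).eq_zero (by simp)]

theorem isWeakDeriv_self (f : L2 L) : IsWeakDeriv L 0 f f := fun φ _ => by simp

/-- Functions `c + ∫₀ˣ g` have the weak derivative `g`. -/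
theorem isWeakDeriv_smul_one_add_V (hL : 0 < L) (c : ℝ) (g : L2 L) :
    IsWeakDeriv L 1 (c • one L + V L g) g := by
  rw [isWeakDeriv_iff]
  intro φ hφ
  have h1 := hφ.inner_toL2_succ_one hL 0
  have h2 := inner_V_add_inner_V hL g (hφ.toL2 1)
  rw [hφ.V_toL2_succ 0, h1] at h2
  rw [inner_add_left, real_inner_smul_left, real_inner_comm, h1]
  linarith

theorem IsWeakDeriv.trans {j k : ℕ} {f g h : L2 L} (hfg : IsWeakDeriv L j f g)
    (hgh : IsWeakDeriv L k g h) : IsWeakDeriv L (j + k) f h := by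
  intro φ hφ
  have h1 := hfg _ (hφ.iteratedDeriv k)
  rw [iteratedDeriv_iteratedDeriv, hgh φ hφ] at h1
  rw [h1, pow_add, mul_assoc]

theorem IsWeakDeriv.of_add {j k : ℕ} {f g h : L2 L} (hfg : IsWeakDeriv L j f g)
    (hfh : IsWeakDeriv L (j + k) f h) : IsWeakDeriv L k g h := by
  intro φ hφ
  have h1 := hfg _ (hφ.iteratedDeriv k)
  rw [iteratedDeriv_iteratedDeriv, hfh φ hφ, pow_add, mul_assoc] at h1
  exact (mul_left_cancel₀ (by simp) h1).symm

theorem IsTest.isWeakDeriv_toL2 (hL : 0 < L) {φ : ℝ → ℝ} (hφ : IsTest L φ) (k : ℕ) :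
    IsWeakDeriv L k (hφ.toL2 0) (hφ.toL2 k) := by
  induction k with
  | zero => exact isWeakDeriv_self _
  | succ k ih =>
    refine ih.trans ?_
    simpa [hφ.V_toL2_succ k] using isWeakDeriv_smul_one_add_V hL 0 (hφ.toL2 (k + 1))

/-- Test functions are dense in `L²(0, L)`. -/
theorem eq_zero_of_inner_toL2 {f : L2 L}
    (h : ∀ φ (hφ : IsTest L φ), inner ℝ f (hφ.toL2 0) = 0) : f = 0 := by
  have h1 : IsWeakDeriv L 0 0 f := isWeakDeriv_iff.2 fun φ hφ => by rw [h, inner_zero_left, mul_zero]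
  exact h1.unique (isWeakDeriv_self 0)

/-- A test function with zero integral is the derivative of a test function. -/
theorem IsTest.exists_deriv_eq (hL : 0 < L) {φ : ℝ → ℝ} (hφ : IsTest L φ)
    (h0 : ∫ t in 0..L, φ t = 0) : ∃ χ, IsTest L χ ∧ deriv χ = φ := by
  have hK : IsCompact (insert (L / 2) (tsupport φ)) := hφ.2.1.isCompact.insert _
  have hK' : insert (L / 2) (tsupport φ) ⊆ Ioo 0 L :=
    insert_subset ⟨by linarith, by linarith⟩ hφ.2.2
  obtain ⟨α, hα, hα'⟩ := hK.exists_isLeast (insert_nonempty _ _)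
  obtain ⟨β, hβ, hβ'⟩ := hK.exists_isGreatest (insert_nonempty _ _)
  have hα0 := hK' hα
  have hβ0 := hK' hβ
  have hlow : ∀ t, t < α → φ t = 0 := fun t ht => image_eq_zero_of_notMem_tsupport fun h =>
    ht.not_ge (hα' (mem_insert_of_mem _ h))
  have hhigh : ∀ t, β < t → φ t = 0 := fun t ht => image_eq_zero_of_notMem_tsupport fun h =>
    ht.not_ge (hβ' (mem_insert_of_mem _ h))
  have hc : Continuous φ := hφ.1.continuous
  set χ : ℝ → ℝ := fun x => ∫ t in 0..x, φ t
  have hd : ∀ x, HasDerivAt χ (φ x) x := fun x => hc.integral_hasStrictDerivAt 0 x |>.hasDerivAt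
  have hd' : deriv χ = φ := funext fun x => (hd x).deriv
  have hsupp : tsupport χ ⊆ Icc α β := by
    refine closure_minimal (fun x hx => ?_) isClosed_Icc
    by_contra hx'
    refine hx ?_
    rcases lt_or_ge x α with h | h
    · refine intervalIntegral.integral_zero_ae (Eventually.of_forall fun t ht => hlow t ?_)
      rcases (mem_uIoc.1 ht) with ⟨_, h2⟩ | ⟨_, h2⟩
      · exact h2.trans_lt h
      · exact h2.trans_lt hα0.1
    · have h' : β < x := by
        by_contra h2
        exact hx' ⟨h, not_lt.1 h2⟩
      change ∫ t in 0..x, φ t = 0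
      rw [← intervalIntegral.integral_add_adjacent_intervals (hc.intervalIntegrable 0 L)
        (hc.intervalIntegrable L x), h0, zero_add]
      refine intervalIntegral.integral_zero_ae (Eventually.of_forall fun t ht => hhigh t ?_)
      rcases (mem_uIoc.1 ht) with ⟨h2, _⟩ | ⟨h2, _⟩
      · exact hβ0.2.trans h2
      · exact h'.trans h2
  refine ⟨χ, ⟨contDiff_infty_iff_deriv.2 ⟨fun x => (hd x).differentiableAt, hd' ▸ hφ.1⟩,
    HasCompactSupport.of_support_subset_isCompact isCompact_Icc ((subset_tsupport _).trans hsupp),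
    hsupp.trans fun x hx => ⟨hα0.1.trans_le hx.1, hx.2.trans_lt hβ0.2⟩⟩, hd'⟩

theorem exists_isTest_integral_eq_one (hL : 0 < L) :
    ∃ ψ, IsTest L ψ ∧ ∫ t in 0..L, ψ t = 1 := by
  let b : ContDiffBump (L / 2 : ℝ) := ⟨L / 8, L / 4, by positivity, by linarith⟩
  have hs : tsupport (b.normed volume) ⊆ Ioo 0 L := by
    rw [b.tsupport_normed_eq, Real.closedBall_eq_Icc]
    intro x hx
    have e : b.rOut = L / 4 := rfl
    rw [e] at hx
    exact ⟨by linarith [hx.1], by linarith [hx.2]⟩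
  refine ⟨b.normed volume, ⟨b.contDiff_normed, b.hasCompactSupport_normed, hs⟩, ?_⟩
  rw [intervalIntegral.integral_of_le hL.le, integral_Ioc_eq_integral_Ioo,
    setIntegral_eq_integral_of_forall_compl_eq_zero fun x hx =>
      image_eq_zero_of_notMem_tsupport fun h => hx (hs h), b.integral_normed]

/-- Every test function is, up to a multiple of a fixed one, the derivative of a test function. -/
theorem exists_toL2_eq (hL : 0 < L) : ∃ ψ, ∃ hψ : IsTest L ψ, ∀ φ (hφ : IsTest L φ),
    ∃ χ, ∃ hχ : IsTest L χ, ∀ k,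
      hφ.toL2 k = hχ.toL2 (k + 1) + inner ℝ (one L) (hφ.toL2 0) • hψ.toL2 k := by
  obtain ⟨ψ, hψ, hψ1⟩ := exists_isTest_integral_eq_one hL
  refine ⟨ψ, hψ, fun φ hφ => ?_⟩
  set m : ℝ := inner ℝ (one L) (hφ.toL2 0) with hm
  have hm' : m = ∫ t in 0..L, φ t := by
    rw [hm, real_inner_comm, inner_one hL,
      intervalIntegral_congr_ae_of_mem (hφ.coeFn_toL2 0) ⟨hL.le, le_rfl⟩, iteratedDeriv_zero]
  have h0 : ∫ t in 0..L, (φ + (-m) • ψ) t = 0 := by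
    simp only [Pi.add_apply, Pi.smul_apply, smul_eq_mul]
    rw [intervalIntegral.integral_add (hφ.1.continuous.intervalIntegrable _ _)
      ((hψ.1.continuous.intervalIntegrable _ _).const_mul _),
      intervalIntegral.integral_const_mul, hψ1, hm']
    ring
  obtain ⟨χ, hχ, hχ'⟩ := (hφ.add (hψ.smul (-m))).exists_deriv_eq hL h0
  refine ⟨χ, hχ, fun k => ?_⟩
  have e : hχ.toL2 (k + 1) = (hφ.add (hψ.smul (-m))).toL2 k := by
    refine Lp.ext ?_
    filter_upwards [hχ.coeFn_toL2 (k + 1), (hφ.add (hψ.smul (-m))).coeFn_toL2 k] with x h1 h2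
    rw [h1, h2, iteratedDeriv_succ', hχ']
  rw [e, hφ.toL2_add (hψ.smul (-m)), hψ.toL2_smul]
  module

/-- The **du Bois-Reymond lemma**. -/
theorem IsWeakDeriv.exists_eq_smul_one_add_V (hL : 0 < L) {f g : L2 L}
    (h : IsWeakDeriv L 1 f g) : ∃ c : ℝ, f = c • one L + V L g := by
  have h0 : IsWeakDeriv L 1 (f + (-1 : ℝ) • V L g) 0 := by
    have := h.add ((isWeakDeriv_smul_one_add_V hL 0 g).smul (-1))
    simpa using this
  rw [isWeakDeriv_iff] at h0
  obtain ⟨ψ, hψ, key⟩ := exists_toL2_eq hL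
  set r := f + (-1 : ℝ) • V L g with hr
  refine ⟨inner ℝ r (hψ.toL2 0), ?_⟩
  have h1 : r - inner ℝ r (hψ.toL2 0) • one L = 0 := by
    refine eq_zero_of_inner_toL2 fun φ hφ => ?_
    obtain ⟨χ, hχ, e⟩ := key φ hφ
    have h2 := h0 χ hχ
    rw [inner_zero_left, mul_zero] at h2
    rw [inner_sub_left, real_inner_smul_left, e 0, inner_add_right, h2, real_inner_smul_right,
      ← e 0]
    ring
  rw [← sub_eq_zero.1 h1, hr]
  module

/-- The du Bois-Reymond lemma of second order: distributional solutions of `f'' = 0` are affine. -/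
theorem IsWeakDeriv.exists_eq_affine (hL : 0 < L) {f : L2 L} (h : IsWeakDeriv L 2 f 0) :
    ∃ c d : ℝ, f = c • one L + V L (d • one L) := by
  rw [isWeakDeriv_iff] at h
  obtain ⟨ψ, hψ, key⟩ := exists_toL2_eq hL
  have h1 : IsWeakDeriv L 1 f ((-inner ℝ f (hψ.toL2 1)) • one L) := by
    rw [isWeakDeriv_iff]
    intro φ hφ
    obtain ⟨χ, hχ, e⟩ := key φ hφ
    have h2 := h χ hχ
    rw [inner_zero_left, mul_zero] at h2
    rw [e 1, inner_add_right, h2, real_inner_smul_right, real_inner_smul_left]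
    ring
  obtain ⟨c, hc⟩ := h1.exists_eq_smul_one_add_V hL
  exact ⟨c, _, hc⟩

end WeakDerivatives

/-! ### Traces -/

section Traces

variable {L : ℝ}

theorem HasTrace.unique (hL : 0 < L) {g : L2 L} {x c d : ℝ} (hx : x ∈ Icc 0 L)
    (hc : HasTrace L g x c) (hd : HasTrace L g x d) : c = d := by
  obtain ⟨F, hF, hFe, rfl⟩ := hc
  obtain ⟨G, hG, hGe, rfl⟩ := hd
  refine Measure.eqOn_Icc_of_ae_eq volume hL.ne ?_ hF hG hx
  rw [← Measure.restrict_congr_set Ioo_ae_eq_Icc]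
  exact hFe.symm.trans hGe

theorem hasTrace_smul_one_add_V (hL : 0 < L) (c : ℝ) (g : L2 L) {x : ℝ} :
    HasTrace L (c • one L + V L g) x (c + prim g x) := by
  refine ⟨fun y => c + prim g y, continuousOn_const.add (continuousOn_prim hL g), ?_, rfl⟩
  filter_upwards [Lp.coeFn_add (c • one L) (V L g), Lp.coeFn_smul c (one L), coeFn_V g,
    coeFn_one (L := L)] with y h1 h2 h3 h4
  rw [h1, Pi.add_apply, h2, Pi.smul_apply, h3, h4, smul_eq_mul, mul_one]

theorem hasTrace_zero_smul_one_add_V (hL : 0 < L) (c : ℝ) (g : L2 L) :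
    HasTrace L (c • one L + V L g) 0 c := by
  simpa [prim] using hasTrace_smul_one_add_V hL c g (x := 0)

theorem hasTrace_right_smul_one_add_V (hL : 0 < L) (c : ℝ) (g : L2 L) :
    HasTrace L (c • one L + V L g) L (c + inner ℝ g (one L)) := by
  rw [inner_one hL]
  exact hasTrace_smul_one_add_V hL c g

theorem IsTest.hasTrace {φ : ℝ → ℝ} (hφ : IsTest L φ) (k : ℕ) {x : ℝ} (hx : x ∉ Ioo 0 L) :
    HasTrace L (hφ.toL2 k) x 0 :=
  ⟨_, (hφ.iteratedDeriv k).1.continuous.continuousOn, hφ.coeFn_toL2 k,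
    (hφ.iteratedDeriv k).eq_zero hx⟩

end Traces

/-! ### The spaces `H^m` and `H^m_0` -/

section SobolevSpaces

variable {L : ℝ}

theorem isWeakDeriv_weakDeriv {m k : ℕ} (hk : k ≤ m) {f : L2 L} (hf : f ∈ H L m) :
    IsWeakDeriv L k f (weakDeriv L k f) := by
  obtain ⟨g, hg⟩ := hf k hk
  rwa [hg.weakDeriv_eq]

theorem isWeakDeriv_weakDeriv_add {m j k : ℕ} (h : j + k ≤ m) {f : L2 L} (hf : f ∈ H L m) :
    IsWeakDeriv L k (weakDeriv L j f) (weakDeriv L (j + k) f) :=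
  (isWeakDeriv_weakDeriv (by omega) hf).of_add (isWeakDeriv_weakDeriv h hf)

theorem IsTest.mem_H (hL : 0 < L) {φ : ℝ → ℝ} (hφ : IsTest L φ) (m : ℕ) : hφ.toL2 0 ∈ H L m :=
  fun k _ => ⟨_, hφ.isWeakDeriv_toL2 hL k⟩

theorem IsTest.toL2_mem_testJets {φ : ℝ → ℝ} (hφ : IsTest L φ) (m : ℕ) :
    (fun k : Fin (m + 1) => hφ.toL2 k) ∈ testJets L m :=
  ⟨φ, hφ, fun k => hφ.coeFn_toL2 k⟩

theorem IsTest.mem_H0 (hL : 0 < L) {φ : ℝ → ℝ} (hφ : IsTest L φ) (m : ℕ) : hφ.toL2 0 ∈ H0 L m := by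
  refine ⟨⟨hφ.toL2 0, hφ.mem_H hL m⟩, ?_, rfl⟩
  refine subset_closure ?_
  have e : jet L m ⟨hφ.toL2 0, hφ.mem_H hL m⟩ = fun k : Fin (m + 1) => hφ.toL2 k :=
    funext fun k => (hφ.isWeakDeriv_toL2 hL k).weakDeriv_eq
  rw [e]
  exact hφ.toL2_mem_testJets m

/-- Weak derivatives can be tested against functions from `H^m_0(0, L)`. -/
theorem inner_eq_of_mem_H0 {m k : ℕ} (hk : k ≤ m) {f g h : L2 L} (hf : f ∈ H0 L m)
    (hgh : IsWeakDeriv L k g h) :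
    inner ℝ g (weakDeriv L k f) = (-1) ^ k * inner ℝ h f := by
  obtain ⟨⟨f', hf'⟩, hcl, rfl⟩ := hf
  have h0 : weakDeriv L 0 f' = f' := (isWeakDeriv_self f').weakDeriv_eq
  have key : ∀ J ∈ (testJets L m).topologicalClosure,
      inner ℝ g (J ⟨k, by omega⟩) = (-1) ^ k * inner ℝ h (J 0) := by
    intro J hJ
    refine closure_minimal (s := (testJets L m : Set (Fin (m + 1) → L2 L)))
      (t := {J | inner ℝ g (J ⟨k, by omega⟩) = (-1) ^ k * inner ℝ h (J 0)}) ?_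
      (isClosed_eq (by fun_prop) (by fun_prop)) hJ
    rintro J ⟨φ, hφ, hJ⟩
    have e : ∀ i, J i = hφ.toL2 i := fun i => Lp.ext ((hJ i).trans (hφ.coeFn_toL2 i).symm)
    simp only [mem_ofPred_eq, e]
    exact isWeakDeriv_iff.1 hgh φ hφ
  have := key _ hcl
  change inner ℝ g (weakDeriv L k f') = (-1) ^ k * inner ℝ h (weakDeriv L 0 f') at this
  rwa [h0] at this

/-- The second derivatives of test functions are dense in the orthogonal complement of the affine
functions. -/
theorem mem_closure_range_toL2_two (hL : 0 < L) {g : L2 L} (h1 : inner ℝ g (one L) = 0)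
    (h2 : inner ℝ (V L g) (one L) = 0) :
    g ∈ closure {h | ∃ φ, ∃ hφ : IsTest L φ, hφ.toL2 2 = h} := by
  let W : Submodule ℝ (L2 L) :=
    { carrier := {h | ∃ φ, ∃ hφ : IsTest L φ, hφ.toL2 2 = h}
      add_mem' := by
        rintro _ _ ⟨φ, hφ, rfl⟩ ⟨ψ, hψ, rfl⟩
        exact ⟨_, _, hφ.toL2_add hψ 2⟩
      zero_mem' := ⟨_, _, toL2_zero L 2⟩
      smul_mem' := by
        rintro c _ ⟨φ, hφ, rfl⟩
        exact ⟨_, _, hφ.toL2_smul c 2⟩ }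
  change g ∈ W.topologicalClosure
  rw [← Submodule.orthogonal_orthogonal_eq_closure, Submodule.mem_orthogonal]
  intro h hh
  rw [Submodule.mem_orthogonal] at hh
  have hw : IsWeakDeriv L 2 h 0 := isWeakDeriv_iff.2 fun φ hφ => by
    rw [real_inner_comm, hh _ ⟨φ, hφ, rfl⟩, inner_zero_left, mul_zero]
  obtain ⟨c, d, rfl⟩ := hw.exists_eq_affine hL
  have e := inner_V_add_inner_V hL (one L) g
  rw [h1, mul_zero, real_inner_comm (V L g), h2, add_zero] at e
  rw [inner_add_left, real_inner_smul_left, real_inner_comm, h1, map_smul, real_inner_smul_left, e]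
  simp

/-- A function of class `H²` whose value and first derivative vanish at both ends of `[0, L]` can
be approximated in `H²` by test functions. -/
theorem mem_H0_two (hL : 0 < L) {g : L2 L} (h1 : inner ℝ g (one L) = 0)
    (h2 : inner ℝ (V L g) (one L) = 0) : V L (V L g) ∈ H0 L 2 := by
  have w : ∀ f, IsWeakDeriv L 1 (V L f) f := fun f => by
    simpa using isWeakDeriv_smul_one_add_V hL 0 f
  have w2 : IsWeakDeriv L 2 (V L (V L g)) g := (w (V L g)).trans (w g)
  have hH : V L (V L g) ∈ H L 2 := by
    intro k hk
    interval_cases k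
    exacts [⟨_, isWeakDeriv_self _⟩, ⟨_, w _⟩, ⟨_, w2⟩]
  refine ⟨⟨_, hH⟩, ?_, rfl⟩
  let J : L2 L → Fin 3 → L2 L := fun h => ![V L (V L h), V L h, h]
  have hJ : Continuous J := by
    refine continuous_pi fun i => ?_
    fin_cases i
    · exact (V L).continuous.comp (V L).continuous
    · exact (V L).continuous
    · exact continuous_id
  have e : jet L 2 ⟨_, hH⟩ = J g := by
    ext1 k
    fin_cases k
    exacts [(isWeakDeriv_self _).weakDeriv_eq, (w _).weakDeriv_eq, w2.weakDeriv_eq]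
  change jet L 2 ⟨_, hH⟩ ∈ closure _
  rw [e]
  refine map_mem_closure hJ (mem_closure_range_toL2_two hL h1 h2) ?_
  rintro _ ⟨φ, hφ, rfl⟩
  have : J (hφ.toL2 2) = fun k : Fin 3 => hφ.toL2 k := by
    ext1 k
    fin_cases k
    · change V L (V L (hφ.toL2 2)) = hφ.toL2 0
      rw [hφ.V_toL2_succ 1, hφ.V_toL2_succ 0]
    · exact hφ.V_toL2_succ 1
    · rfl
  rw [this]
  exact hφ.toL2_mem_testJets 2

end SobolevSpaces

/-! ### Trace functionals on `H^m` -/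

section TraceFunctionals

variable {L : ℝ} {m : ℕ}

/-- The value at `0` of the `k`-th derivative of `f ∈ H^m(0, L)`, for `k < m`: the constant `c` in
`f^(k) = c + V f^(k+1)`, expressed by a formula that is linear in `f`. -/
noncomputable def leftTrace (L : ℝ) {m : ℕ} (k : Fin m) : H L m →ₗ[ℝ] ℝ :=
  L⁻¹ • (innerₛₗ ℝ (one L)) ∘ₗ (LinearMap.proj k.castSucc ∘ₗ jet L m -
    (V L : L2 L →ₗ[ℝ] L2 L) ∘ₗ LinearMap.proj k.succ ∘ₗ jet L m)

/-- The value at `L` of the `k`-th derivative of `f ∈ H^m(0, L)`, for `k < m`. -/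
noncomputable def rightTrace (L : ℝ) {m : ℕ} (k : Fin m) : H L m →ₗ[ℝ] ℝ :=
  leftTrace L k + (innerₛₗ ℝ (one L)) ∘ₗ LinearMap.proj k.succ ∘ₗ jet L m

theorem leftTrace_apply (k : Fin m) (f : H L m) :
    leftTrace L k f = L⁻¹ * inner ℝ (one L) (weakDeriv L k f - V L (weakDeriv L (k + 1) f)) := rfl

theorem rightTrace_apply (k : Fin m) (f : H L m) :
    rightTrace L k f = leftTrace L k f + inner ℝ (weakDeriv L (k + 1) f) (one L) := by
  rw [real_inner_comm]
  rfl

theorem leftTrace_eq (hL : 0 < L) {k : Fin m} {f : H L m} {c : ℝ}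
    (h : weakDeriv L k f = c • one L + V L (weakDeriv L (k + 1) f)) : leftTrace L k f = c := by
  rw [leftTrace_apply, h, add_sub_cancel_right, real_inner_smul_right, inner_one_one hL]
  field_simp

theorem weakDeriv_eq_leftTrace (hL : 0 < L) (k : Fin m) (f : H L m) :
    weakDeriv L k f = leftTrace L k f • one L + V L (weakDeriv L (k + 1) f) := by
  obtain ⟨c, hc⟩ := (isWeakDeriv_weakDeriv_add (j := k) (k := 1) k.2 f.2).exists_eq_smul_one_add_V hL
  rwa [leftTrace_eq hL hc]

theorem hasTrace_leftTrace (hL : 0 < L) (k : Fin m) (f : H L m) :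
    HasTrace L (weakDeriv L k f) 0 (leftTrace L k f) := by
  have := hasTrace_zero_smul_one_add_V hL (leftTrace L k f) (weakDeriv L (k + 1) f)
  rwa [← weakDeriv_eq_leftTrace hL] at this

theorem hasTrace_rightTrace (hL : 0 < L) (k : Fin m) (f : H L m) :
    HasTrace L (weakDeriv L k f) L (rightTrace L k f) := by
  have := hasTrace_right_smul_one_add_V hL (leftTrace L k f) (weakDeriv L (k + 1) f)
  rwa [← weakDeriv_eq_leftTrace hL, ← rightTrace_apply] at this

theorem weakDeriv_zero (f : L2 L) : weakDeriv L 0 f = f := (isWeakDeriv_self f).weakDeriv_eq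

theorem mem_H0_two_of_traces (hL : 0 < L) {f : H L 5} (h0 : leftTrace L 0 f = 0)
    (h1 : leftTrace L 1 f = 0) (h2 : rightTrace L 0 f = 0) (h3 : rightTrace L 1 f = 0) :
    (f : L2 L) ∈ H0 L 2 := by
  have e0 := weakDeriv_eq_leftTrace hL 0 f
  have e1 := weakDeriv_eq_leftTrace hL 1 f
  rw [rightTrace_apply, h0, zero_add] at h2
  rw [rightTrace_apply, h1, zero_add] at h3
  rw [h0, zero_smul, zero_add] at e0
  rw [h1, zero_smul, zero_add] at e1
  change weakDeriv L 0 f = V L (weakDeriv L 1 f) at e0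
  change weakDeriv L 1 f = V L (weakDeriv L 2 f) at e1
  change inner ℝ (weakDeriv L 1 f) (one L) = 0 at h2
  change inner ℝ (weakDeriv L 2 f) (one L) = 0 at h3
  rw [← weakDeriv_zero (f : L2 L), e0, e1]
  exact mem_H0_two hL h3 (e1 ▸ h2)

/-- A function with prescribed traces and prescribed highest derivative, from its Taylor
coefficients: `P k` is to be the `k`-th derivative of `P 0`. -/
theorem exists_mem_H_of_eq (hL : 0 < L) {y : Fin m → ℝ} {P : Fin (m + 1) → L2 L}
    (h : ∀ k : Fin m, P k.castSucc = y k • one L + V L (P k.succ)) :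
    ∃ f : H L m, (∀ k : Fin (m + 1), weakDeriv L k f = P k) ∧ ∀ k, leftTrace L k f = y k := by
  have key : ∀ k : Fin (m + 1), IsWeakDeriv L k (P 0) (P k) := by
    intro k
    induction k using Fin.induction with
    | zero => exact isWeakDeriv_self _
    | succ k ih =>
      refine ih.trans ?_
      rw [h k]
      exact isWeakDeriv_smul_one_add_V hL _ _
  have key' : ∀ k : Fin (m + 1), weakDeriv L k (P 0) = P k := fun k => (key k).weakDeriv_eq
  refine ⟨⟨P 0, fun k hk => ⟨_, key ⟨k, by omega⟩⟩⟩, key', fun k => leftTrace_eq hL ?_⟩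
  have e1 := key' k.castSucc
  have e2 := key' k.succ
  rw [Fin.val_castSucc] at e1
  rw [Fin.val_succ] at e2
  change weakDeriv L k (P 0) = y k • one L + V L (weakDeriv L (k + 1) (P 0))
  rw [e1, e2, h k]

end TraceFunctionals

/-! ### The operator `A` -/

section Operator

variable {L a b α₁ α₂ : ℝ}

theorem SecondOrderBC.trace_left (hL : 0 < L) {γ : ℝ} {η u : H L 5}
    (h : SecondOrderBC L γ 0 (η : L2 L) (u : L2 L)) :
    leftTrace L 2 u + γ * leftTrace L 2 η = 0 := by
  obtain ⟨c, d, hc, hd, e⟩ := h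
  rw [(hasTrace_leftTrace hL 2 u).unique hL ⟨le_rfl, hL.le⟩ hc,
    (hasTrace_leftTrace hL 2 η).unique hL ⟨le_rfl, hL.le⟩ hd, e]

theorem SecondOrderBC.trace_right (hL : 0 < L) {γ : ℝ} {η u : H L 5}
    (h : SecondOrderBC L γ L (η : L2 L) (u : L2 L)) :
    rightTrace L 2 u + γ * rightTrace L 2 η = 0 := by
  obtain ⟨c, d, hc, hd, e⟩ := h
  rw [(hasTrace_rightTrace hL 2 u).unique hL ⟨hL.le, le_rfl⟩ hc,
    (hasTrace_rightTrace hL 2 η).unique hL ⟨hL.le, le_rfl⟩ hd, e]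

/-- Green's formula: all lower-order terms cancel, and only the second derivatives at the ends of
the interval remain. -/
theorem inner_diffExpr_add_inner_diffExpr (hL : 0 < L) (η u : H L 5)
    (hη : (η : L2 L) ∈ H0 L 2) (hu : (u : L2 L) ∈ H0 L 2) :
    inner ℝ (diffExpr L a b u) (η : L2 L) + inner ℝ (diffExpr L a b η) (u : L2 L) =
      -b * (rightTrace L 2 u * rightTrace L 2 η - leftTrace L 2 u * leftTrace L 2 η) := by
  have w : ∀ (f : H L 5) (j k : ℕ), j + k ≤ 5 →
      IsWeakDeriv L k (weakDeriv L j f) (weakDeriv L (j + k) f) :=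
    fun f j k h => isWeakDeriv_weakDeriv_add h f.2
  have h1 := inner_eq_of_mem_H0 (by norm_num) hη (w u 0 1 (by norm_num))
  have h3 := inner_eq_of_mem_H0 (by norm_num) hη (w u 1 2 (by norm_num))
  have h3' := inner_eq_of_mem_H0 (by norm_num) hu (w η 2 1 (by norm_num))
  have h5 := inner_eq_of_mem_H0 (by norm_num) hη (w u 3 2 (by norm_num))
  have h5' := inner_eq_of_mem_H0 (by norm_num) hu (w η 3 2 (by norm_num))
  have c1 := real_inner_comm (u : L2 L) (weakDeriv L 1 η)
  have c3 := real_inner_comm (weakDeriv L 1 u) (weakDeriv L 2 η)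
  have eη := weakDeriv_eq_leftTrace hL 2 η
  have eu := weakDeriv_eq_leftTrace hL 2 u
  have hb : inner ℝ (weakDeriv L 3 u) (weakDeriv L 2 η) +
      inner ℝ (weakDeriv L 3 η) (weakDeriv L 2 u) =
      rightTrace L 2 u * rightTrace L 2 η - leftTrace L 2 u * leftTrace L 2 η := by
    have e := inner_V_add_inner_V hL (weakDeriv L 3 u) (weakDeriv L 3 η)
    rw [real_inner_comm] at e
    change weakDeriv L 2 η = _ • one L + V L (weakDeriv L 3 η) at eη
    change weakDeriv L 2 u = _ • one L + V L (weakDeriv L 3 u) at eu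
    rw [eη, eu, inner_add_right, inner_add_right, real_inner_smul_right, real_inner_smul_right,
      rightTrace_apply, rightTrace_apply]
    change _ = (leftTrace L 2 u + inner ℝ (weakDeriv L 3 u) (one L)) *
      (leftTrace L 2 η + inner ℝ (weakDeriv L 3 η) (one L)) - _
    linear_combination e
  rw [weakDeriv_zero] at h1
  norm_num at h1 h3 h3' h5 h5'
  simp only [diffExpr, inner_add_left, inner_sub_left, inner_neg_left, real_inner_smul_left]
  rw [← hb, h5, h5']
  linear_combination -h1 - c1 - a * h3 + a * h3' - a * c3

theorem isDissipative_A (hL : 0 < L) (hb : 0 < b) (hα₁ : 0 ≤ α₁) (hα₂ : 0 ≤ α₂) :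
    IsDissipative (A L a b α₁ α₂) := by
  rintro ⟨U, hη, hu, h0, h1⟩
  have key := inner_diffExpr_add_inner_diffExpr (a := a) (b := b) hL
    ⟨U.fst, hη.1⟩ ⟨U.snd, hu.1⟩ hη.2 hu.2
  have t0 := SecondOrderBC.trace_left hL (η := ⟨U.fst, hη.1⟩) (u := ⟨U.snd, hu.1⟩) h0
  have t1 := SecondOrderBC.trace_right hL (η := ⟨U.fst, hη.1⟩) (u := ⟨U.snd, hu.1⟩) h1
  rw [WithLp.prod_inner_apply]
  change inner ℝ (diffExpr L a b U.snd) U.fst + inner ℝ (diffExpr L a b U.fst) U.snd ≤ 0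
  simp only at key
  rw [key, eq_neg_of_add_eq_zero_left t0, eq_neg_of_add_eq_zero_left t1]
  set r := rightTrace L 2 (⟨U.fst, hη.1⟩ : H L 5)
  set l := leftTrace L 2 (⟨U.fst, hη.1⟩ : H L 5)
  have : 0 ≤ b * (α₂ * r ^ 2 + α₁ * l ^ 2) := by positivity
  linarith

theorem dense_domain_A (hL : 0 < L) : Dense ((A L a b α₁ α₂).domain : Set (X0 L)) := by
  change Dense ((domainA L α₁ α₂ : Submodule ℝ (X0 L)) : Set (X0 L))
  have bc : ∀ {φ ψ : ℝ → ℝ} (hφ : IsTest L φ) (hψ : IsTest L ψ) (γ x : ℝ), x ∉ Ioo 0 L →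
      SecondOrderBC L γ x (hφ.toL2 0) (hψ.toL2 0) := by
    intro φ ψ hφ hψ γ x hx
    refine ⟨0, 0, ?_, ?_, by ring⟩
    · rw [(hψ.isWeakDeriv_toL2 hL 2).weakDeriv_eq]
      exact hψ.hasTrace 2 hx
    · rw [(hφ.isWeakDeriv_toL2 hL 2).weakDeriv_eq]
      exact hφ.hasTrace 2 hx
  have hmem : ∀ {φ ψ : ℝ → ℝ} (hφ : IsTest L φ) (hψ : IsTest L ψ),
      WithLp.toLp 2 (hφ.toL2 0, hψ.toL2 0) ∈ domainA L α₁ α₂ := fun hφ hψ =>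
    ⟨⟨hφ.mem_H hL 5, hφ.mem_H0 hL 2⟩, ⟨hψ.mem_H hL 5, hψ.mem_H0 hL 2⟩,
      bc hφ hψ _ _ (by simp), bc hφ hψ _ _ (by simp)⟩
  rw [Submodule.dense_iff_topologicalClosure_eq_top, Submodule.topologicalClosure_eq_top_iff,
    Submodule.eq_bot_iff]
  intro U hU
  rw [Submodule.mem_orthogonal'] at hU
  have h1 : U.fst = 0 := eq_zero_of_inner_toL2 fun φ hφ => by
    have := hU _ (hmem hφ (isTest_zero L))
    rw [WithLp.prod_inner_apply, toL2_zero] at this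
    simpa using this
  have h2 : U.snd = 0 := eq_zero_of_inner_toL2 fun φ hφ => by
    have := hU _ (hmem (isTest_zero L) hφ)
    rw [WithLp.prod_inner_apply, toL2_zero] at this
    simpa using this
  exact WithLp.ofLp_injective 2 (Prod.ext h1 h2)

/-- The initial value problem for the scalar equation `p + κ (-p' + a p''' - b p^(5)) = r`. In terms
of the highest derivative `w = p^(5)` it reads `(κ b - V Q) w = g` with a polynomial `Q` in the
Volterra operator. -/
theorem exists_add_smul_diffExpr_eq (hL : 0 < L) (hb : b ≠ 0) {κ : ℝ} (hκ : κ ≠ 0)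
    (y : Fin 5 → ℝ) (r : L2 L) :
    ∃ p : H L 5, (p : L2 L) + κ • diffExpr L a b p = r ∧ ∀ k, leftTrace L k p = y k := by
  let Q : L2 L →L[ℝ] L2 L := V L ^ 4 - κ • V L ^ 3 + (κ * a) • V L
  have hQ : Commute (V L) Q :=
    (((Commute.refl _).pow_right 4).sub_right (((Commute.refl _).pow_right 3).smul_right κ)).add_right
      ((Commute.refl _).smul_right _)
  -- the Taylor polynomials of the unknown function and of its derivatives
  let q4 := y 4 • one L
  let q3 := y 3 • one L + V L q4
  let q2 := y 2 • one L + V L q3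
  let q1 := y 1 • one L + V L q2
  let q0 := y 0 • one L + V L q1
  obtain ⟨S, hS⟩ := isUnit_smul_one_sub_V_mul hL hQ (mul_ne_zero hκ hb)
  let w := (↑S⁻¹ : L2 L →L[ℝ] L2 L) (q0 - κ • q1 + (κ * a) • q3 - r)
  have hw : (κ * b) • w - V L (Q w) = q0 - κ • q1 + (κ * a) • q3 - r := by
    have := congrArg (fun F : L2 L →L[ℝ] L2 L => F (q0 - κ • q1 + (κ * a) • q3 - r)) S.mul_inv
    rwa [hS] at this
  let P : Fin 6 → L2 L := ![q0 + (V L ^ 5) w, q1 + (V L ^ 4) w, q2 + (V L ^ 3) w,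
    q3 + (V L ^ 2) w, q4 + V L w, w]
  obtain ⟨p, hp, hp'⟩ := exists_mem_H_of_eq hL (y := y) (P := P) (fun k => by
    fin_cases k
    · change q0 + (V L ^ 5) w = y 0 • one L + V L (q1 + (V L ^ 4) w)
      rw [pow_succ' _ 4, mul_apply_eq_comp, map_add, ← add_assoc]
    · change q1 + (V L ^ 4) w = y 1 • one L + V L (q2 + (V L ^ 3) w)
      rw [pow_succ' _ 3, mul_apply_eq_comp, map_add, ← add_assoc]
    · change q2 + (V L ^ 3) w = y 2 • one L + V L (q3 + (V L ^ 2) w)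
      rw [pow_succ' _ 2, mul_apply_eq_comp, map_add, ← add_assoc]
    · change q3 + (V L ^ 2) w = y 3 • one L + V L (q4 + V L w)
      rw [pow_succ' _ 1, pow_one, mul_apply_eq_comp, map_add, ← add_assoc]
    · rfl)
  refine ⟨p, ?_, hp'⟩
  have e0 : (p : L2 L) = q0 + (V L ^ 5) w := (weakDeriv_zero _).symm.trans (hp 0)
  have e1 : weakDeriv L 1 p = q1 + (V L ^ 4) w := hp 1
  have e3 : weakDeriv L 3 p = q3 + (V L ^ 2) w := hp 3
  have e5 : weakDeriv L 5 p = w := hp 5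
  have hVQ : V L (Q w) = (V L ^ 5) w - κ • (V L ^ 4) w + (κ * a) • (V L ^ 2) w := by
    have hV : ∀ n, (V L ^ (n + 1)) w = V L ((V L ^ n) w) := fun n => by rw [pow_succ']; rfl
    simp only [Q, add_apply, sub_apply, smul_apply, map_add, map_sub, map_smul]
    rw [← hV 4, ← hV 3, hV 1, pow_one]
  rw [diffExpr, e1, e3, e5, e0]
  rw [hVQ] at hw
  rw [← sub_eq_zero] at hw ⊢
  rw [← neg_eq_zero, ← hw]
  module

/-- The square system behind a boundary value problem. If `P x = r` is solvable for arbitrary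
initial data `I x`, and there are as many boundary conditions `B x = 0` as initial data, then
uniqueness for the boundary value problem implies existence. -/
theorem exists_eq_of_boundary_injective {E F W W' : Type*} [AddCommGroup E] [Module ℝ E]
    [AddCommGroup F] [Module ℝ F] [AddCommGroup W] [Module ℝ W] [AddCommGroup W'] [Module ℝ W']
    [FiniteDimensional ℝ W']
    (hW : Module.finrank ℝ W = Module.finrank ℝ W') (P : E →ₗ[ℝ] F) (I : E →ₗ[ℝ] W)
    (B : E →ₗ[ℝ] W') (hPI : ∀ r w, ∃ x, P x = r ∧ I x = w)
    (hB : ∀ x, P x = 0 → B x = 0 → x = 0) (r : F) : ∃ x, P x = r ∧ B x = 0 := by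
  let N := LinearMap.ker P
  have hinj : Function.Injective (B.domRestrict N) := by
    rw [← LinearMap.ker_eq_bot, LinearMap.ker_eq_bot']
    exact fun x hx => Subtype.ext (hB x x.2 hx)
  have hfin : FiniteDimensional ℝ N := FiniteDimensional.of_injective _ hinj
  have hsurj : Function.Surjective (I.domRestrict N) := fun w => by
    obtain ⟨x, hx, hx'⟩ := hPI 0 w
    exact ⟨⟨x, hx⟩, hx'⟩
  have h1 := LinearMap.finrank_le_finrank_of_injective hinj
  have h2 := LinearMap.finrank_le_finrank_of_surjective hsurj
  have h3 := (LinearMap.injective_iff_surjective_of_finrank_eq_finrank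
    (h1.antisymm (hW ▸ h2))).1 hinj
  obtain ⟨x, hx, -⟩ := hPI r 0
  obtain ⟨n, hn⟩ := h3 (B x)
  have hn' : P n = 0 := n.2
  refine ⟨x - n, by rw [map_sub, hx, hn', sub_zero], ?_⟩
  rw [map_sub, sub_eq_zero]
  exact hn.symm

/-- `diffExpr` as a linear map on `H⁵(0, L)`. -/
noncomputable def diffExprₗ (L a b : ℝ) : H L 5 →ₗ[ℝ] L2 L where
  toFun f := diffExpr L a b f
  map_add' f g := diffExpr_add f.2 g.2
  map_smul' c f := diffExpr_smul c f.2

/-- The expression `U - l A U` on `H⁵(0, L)²`, without boundary conditions. -/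
noncomputable def resolventExpr (L a b l : ℝ) : H L 5 × H L 5 →ₗ[ℝ] L2 L × L2 L :=
  LinearMap.prod
    ((H L 5).subtype ∘ₗ LinearMap.fst ℝ _ _ - l • diffExprₗ L a b ∘ₗ LinearMap.snd ℝ _ _)
    ((H L 5).subtype ∘ₗ LinearMap.snd ℝ _ _ - l • diffExprₗ L a b ∘ₗ LinearMap.fst ℝ _ _)

theorem resolventExpr_apply (l : ℝ) (x : H L 5 × H L 5) :
    resolventExpr L a b l x =
      ((x.1 : L2 L) - l • diffExpr L a b x.2, (x.2 : L2 L) - l • diffExpr L a b x.1) := rfl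

/-- The ten boundary values that have to vanish for a member of `H⁵(0, L)²` to be in `D(A)`. -/
noncomputable def boundaryValues (L α₁ α₂ : ℝ) : H L 5 × H L 5 →ₗ[ℝ] (Fin 10 → ℝ) :=
  LinearMap.pi ![
    leftTrace L 0 ∘ₗ LinearMap.fst ℝ _ _, leftTrace L 1 ∘ₗ LinearMap.fst ℝ _ _,
    rightTrace L 0 ∘ₗ LinearMap.fst ℝ _ _, rightTrace L 1 ∘ₗ LinearMap.fst ℝ _ _,
    leftTrace L 0 ∘ₗ LinearMap.snd ℝ _ _, leftTrace L 1 ∘ₗ LinearMap.snd ℝ _ _,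
    rightTrace L 0 ∘ₗ LinearMap.snd ℝ _ _, rightTrace L 1 ∘ₗ LinearMap.snd ℝ _ _,
    leftTrace L 2 ∘ₗ LinearMap.snd ℝ _ _ + α₁ • leftTrace L 2 ∘ₗ LinearMap.fst ℝ _ _,
    rightTrace L 2 ∘ₗ LinearMap.snd ℝ _ _ + (-α₂) • rightTrace L 2 ∘ₗ LinearMap.fst ℝ _ _]

theorem mem_domainA_of_boundaryValues_eq_zero (hL : 0 < L) {x : H L 5 × H L 5}
    (h : boundaryValues L α₁ α₂ x = 0) :
    WithLp.toLp 2 ((x.1 : L2 L), (x.2 : L2 L)) ∈ domainA L α₁ α₂ := by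
  have h' := fun i => congrFun h i
  refine ⟨⟨x.1.2, mem_H0_two_of_traces hL (h' 0) (h' 1) (h' 2) (h' 3)⟩,
    ⟨x.2.2, mem_H0_two_of_traces hL (h' 4) (h' 5) (h' 6) (h' 7)⟩,
    ⟨_, _, hasTrace_leftTrace hL 2 x.2, hasTrace_leftTrace hL 2 x.1, h' 8⟩,
    ⟨_, _, hasTrace_rightTrace hL 2 x.2, hasTrace_rightTrace hL 2 x.1, h' 9⟩⟩

/-- The system decouples in the unknowns `η + u` and `η - u`. -/
theorem exists_resolventExpr_eq (hL : 0 < L) (hb : b ≠ 0) {l : ℝ} (hl : l ≠ 0) (r : L2 L × L2 L)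
    (w : (Fin 5 → ℝ) × (Fin 5 → ℝ)) :
    ∃ x : H L 5 × H L 5, resolventExpr L a b l x = r ∧
      ((LinearMap.pi (leftTrace L)).prodMap (LinearMap.pi (leftTrace L))) x = w := by
  obtain ⟨p, hp, hp'⟩ := exists_add_smul_diffExpr_eq (a := a) hL hb (neg_ne_zero.2 hl)
    (w.1 + w.2) (r.1 + r.2)
  obtain ⟨q, hq, hq'⟩ := exists_add_smul_diffExpr_eq (a := a) hL hb hl (w.1 - w.2) (r.1 - r.2)
  refine ⟨((2⁻¹ : ℝ) • (p + q), (2⁻¹ : ℝ) • (p - q)), ?_, ?_⟩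
  · have hD : ∀ f : H L 5, diffExpr L a b f = diffExprₗ L a b f := fun _ => rfl
    rw [resolventExpr_apply, hD, hD]
    rw [hD] at hp hq
    simp only [map_smul, map_add, map_sub, Submodule.coe_smul, Submodule.coe_add,
      Submodule.coe_sub]
    refine Prod.ext ?_ ?_
    · have : r.1 = (2⁻¹ : ℝ) • ((r.1 + r.2) + (r.1 - r.2)) := by module
      rw [this, ← hp, ← hq]
      module
    · have : r.2 = (2⁻¹ : ℝ) • ((r.1 + r.2) - (r.1 - r.2)) := by module
      rw [this, ← hp, ← hq]
      module
  · refine Prod.ext (funext fun k => ?_) (funext fun k => ?_)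
    · change leftTrace L k ((2⁻¹ : ℝ) • (p + q)) = w.1 k
      rw [map_smul, map_add, hp', hq', Pi.add_apply, Pi.sub_apply, smul_eq_mul]
      ring
    · change leftTrace L k ((2⁻¹ : ℝ) • (p - q)) = w.2 k
      rw [map_smul, map_sub, hp', hq', Pi.add_apply, Pi.sub_apply, smul_eq_mul]
      ring

/-- The range condition. Uniqueness for the boundary value problem `U - l A U = F` comes from
dissipativity; existence follows by counting dimensions. -/
theorem exists_sub_smul_A_eq (hL : 0 < L) (hb : 0 < b) (hα₁ : 0 ≤ α₁) (hα₂ : 0 ≤ α₂) {l : ℝ}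
    (hl : 0 < l) (F : X0 L) :
    ∃ U : (A L a b α₁ α₂).domain, (U : X0 L) - l • A L a b α₁ α₂ U = F := by
  have hA : ∀ (x : H L 5 × H L 5) (hx : boundaryValues L α₁ α₂ x = 0),
      WithLp.toLp 2 ((x.1 : L2 L), (x.2 : L2 L)) - l • A L a b α₁ α₂
        ⟨_, mem_domainA_of_boundaryValues_eq_zero hL hx⟩ =
      WithLp.toLp 2 (resolventExpr L a b l x) := fun _ _ => rfl
  obtain ⟨x, hx, hx'⟩ := exists_eq_of_boundary_injective (by simp) (resolventExpr L a b l)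
    ((LinearMap.pi (leftTrace L)).prodMap (LinearMap.pi (leftTrace L)))
    (boundaryValues L α₁ α₂) (exists_resolventExpr_eq hL hb.ne' hl.ne') (by
      intro x h1 h2
      have h3 := (isDissipative_A (a := a) hL hb hα₁ hα₂).norm_le_norm_sub hl.le
        ⟨_, mem_domainA_of_boundaryValues_eq_zero hL h2⟩
      rw [hA x h2, h1, WithLp.toLp_zero, norm_zero, norm_le_zero_iff] at h3
      have h4 : ((x.1 : L2 L), (x.2 : L2 L)) = 0 := WithLp.toLp_injective 2 h3
      exact Prod.ext (Subtype.ext (congrArg Prod.fst h4)) (Subtype.ext (congrArg Prod.snd h4)))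
    (WithLp.ofLp F)
  exact ⟨⟨_, mem_domainA_of_boundaryValues_eq_zero hL hx'⟩, by rw [hA x hx', hx, WithLp.toLp_ofLp]⟩

end Operator

end FifthOrderKdV

theorem proposition2p1 (L a b α₁ α₂ : ℝ) (hL : 0 < L) (ha : 0 < a) (hb : 0 < b)
    (hα₁ : 0 ≤ α₁) (hα₂ : 0 ≤ α₂) :
    FifthOrderKdV.GeneratesContractionSemigroup (FifthOrderKdV.A L a b α₁ α₂) ∧
      Dense ((FifthOrderKdV.A L a b α₁ α₂).domain : Set (FifthOrderKdV.X0 L)) ∧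
      FifthOrderKdV.IsDissipative (FifthOrderKdV.A L a b α₁ α₂) ∧
      FifthOrderKdV.IsDissipative (FifthOrderKdV.A L a b α₁ α₂).adjoint := by
  have h1 := FifthOrderKdV.isDissipative_A (a := a) hL hb hα₁ hα₂
  have h2 := FifthOrderKdV.dense_domain_A (a := a) (b := b) (α₁ := α₁) (α₂ := α₂) hL
  have h3 := fun (l : ℝ) (hl : 0 < l) =>
    FifthOrderKdV.exists_sub_smul_A_eq (a := a) hL hb hα₁ hα₂ hl
  exact ⟨h1.generatesContractionSemigroup h2 h3, h2, h1, h1.adjoint h2 h3⟩
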